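/- Let $q$ be a power (with positive exponent) of a prime $p$ and let $n>1$ be an integer. For $\mathbf b=(b_1,\dots,b_n)\in\mathbb R^n$ put $$g_{\mathbf b}=(x^{2n}+1)+b_1(x^{2n-1}+x)+\cdots+b_{n-1}(x^{n+1}+x^{n-1})+b_nx^n,$$ and let $V_n$ be the set of those $\mathbf b\in\mathbb R^n$ such that all complex roots of $g_{\mathbf b}$ lie on the unit circle. Let $\mathbf e_1,\dots,\mathbf e_n$ be the standard basis of $\mathbb R^n$. Let $\Lambda_q$ be the lattice generated by the vectors $q^{-i/2}\mathbf e_i$ for $1\le i\le n$; let $\Lambda'_q$ be the lattice generated by the same vectors except that $q^{-n/2}\mathbf e_n$ is replaced with $p\,q^{-n/2}\mathbf e_n$; and let $\Lambda''_q$ be the lattice generated by the same vectors as $\Lambda_q$ except that $q^{-n/2}\mathbf e_n$ is replaced with $s\,q^{-n/2}\mathbf e_n$, where $s$ is the smallest power of $p$ such that $q\mid s^2$. Let $$v_n=\frac{2^n}{n!}\prod_{j=1}^n\left(\frac{2j}{2j-1}\right)^{n+1-j},\qquad r(q)=\frac{\varphi(q)}{q},$$ with $\varphi$ Euler's function, and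 let $$c_1=\frac{\sqrt3}{6},\qquad c_2=\frac{2e^{3/2}(1+\sqrt2)\sqrt3\,(1+\sqrt3/162)^3}{3},\qquad c_3=\frac{c_2}{1+\sqrt2}.$$ Then the sets $\Lambda_q\cap V_n$, $\Lambda'_q\cap V_n$ and $\Lambda''_q\cap V_n$ are finite, $$\bigl|\#(\Lambda_q\cap V_n)-\#(\Lambda'_q\cap V_n)-v_n\,r(q)\,q^{n(n+1)/4}\bigr|\le 6^{n^2}c_1^n c_2\,\frac{n(n+1)}{(n-1)!}\,q^{(n+2)(n-1)/4},$$ and $$\#(\Lambda''_q\cap V_n)\le\left(v_n+6^{n^2}c_1^n c_3\,\frac{n(n+1)}{(n-1)!}\right)q^{(n+2)(n-1)/4}.$$ -/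

import Mathlib

/-!
All roots of `g b` lie on the unit circle exactly when `x⁻ⁿ g b`, a monic polynomial of degree `n`
in `x + x⁻¹`, splits over `[-2, 2]`. Hence `V n` is the image of the cube `[-2, 2]ⁿ` under the map
`coeffMap` from the roots `x + x⁻¹` to the coefficients `b`. The Jacobian of this map is a
Vandermonde determinant, so the volume of `V n` is `1 / n!` times a Selberg integral, which equals
`n! v n`.

A line parallel to the axis of `bᵢ` corresponds to a pencil `h + t T` with `deg T < deg h = n` and
`T` squarefree. A boundary point of `V n` on this line yields a double root of `h + t T`, which is a
zero of the Wronskian of `h` and `T`, or a root at `±2`; so there are at most `2 n` of them.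
Replacing one at a time the counting measures on the lattice coordinates by multiples of Lebesgue
measure therefore changes the measure of `V n` by a controlled amount, and the number of lattice
points differs from volume over covolume by an error of lower order in `q`.
-/


namespace UnitCircleLattice

noncomputable section

open Polynomial

/-- For `b = (b₁, …, bₙ)`, the polynomial
`(x^(2n) + 1) + b₁ (x^(2n-1) + x) + ⋯ + b_{n-1} (x^(n+1) + x^(n-1)) + bₙ xⁿ`.
The coordinate `bᵢ` of the usual numbering is `b ⟨i - 1, _⟩`. -/
def g {n : ℕ} (b : Fin n → ℝ) : ℝ[X] :=
  (X ^ (2 * n) + 1) +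
    ∑ i : Fin n,
      if (i : ℕ) + 1 < n then
        C (b i) * (X ^ (2 * n - ((i : ℕ) + 1)) + X ^ ((i : ℕ) + 1))
      else C (b i) * X ^ n

/-- The vectors `b` for which all complex roots of `g b` lie on the unit circle. -/
def V (n : ℕ) : Set (Fin n → ℝ) :=
  {b | ∀ z : ℂ, aeval z (g b) = 0 → ‖z‖ = 1}

/-- `v n = (2ⁿ / n!) ∏_{j=1}^{n} (2j / (2j - 1))^(n + 1 - j)`. -/
def v (n : ℕ) : ℝ :=
  (2 : ℝ) ^ n / (n.factorial : ℝ) *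
    ∏ j ∈ Finset.Icc 1 n, (2 * (j : ℝ) / (2 * (j : ℝ) - 1)) ^ (n + 1 - j)

/-- `r x = φ(x) / x`, with `φ` Euler's function. -/
def r (x : ℕ) : ℝ := (x.totient : ℝ) / (x : ℝ)

def c₁ : ℝ := √3 / 6

def c₂ : ℝ := Real.exp (3 / 2) * 2 * (1 + √2) * √3 * (1 + √3 / 162) ^ 3 / 3

def c₃ : ℝ := c₂ / (1 + √2)

/-- The lattice generated by `q^(-i/2) eᵢ` for `1 ≤ i < n` and `t q^(-n/2) eₙ`. -/
def scaledLattice (n q t : ℕ) : AddSubgroup (Fin n → ℝ) :=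
  AddSubgroup.closure (Set.range fun i : Fin n =>
    (Pi.single i ((if (i : ℕ) + 1 = n then (t : ℝ) else 1) *
      (q : ℝ) ^ (-(((i : ℕ) : ℝ) + 1) / 2)) : Fin n → ℝ))

/-- The smallest power of `p` whose square is divisible by `q`. -/
def s (p q : ℕ) : ℕ := sInf {m : ℕ | (∃ k : ℕ, m = p ^ k) ∧ q ∣ m ^ 2}

/-- The lattice `Λ_q`, generated by the `q^(-i/2) eᵢ`. -/
def Lam (n q : ℕ) : AddSubgroup (Fin n → ℝ) := scaledLattice n q 1

/-- The lattice `Λ'_q`: the generator `q^(-n/2) eₙ` is replaced with `p q^(-n/2) eₙ`. -/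
def Lam' (n p q : ℕ) : AddSubgroup (Fin n → ℝ) := scaledLattice n q p

/-- The lattice `Λ''_q`: the generator `q^(-n/2) eₙ` is replaced with `s q^(-n/2) eₙ`. -/
def Lam'' (n p q : ℕ) : AddSubgroup (Fin n → ℝ) := scaledLattice n q (s p q)

end

end UnitCircleLattice

namespace UnitCircleLattice

section LatticePoints

open MeasureTheory Finset

theorem subset_or_disjoint_of_disjoint_frontier {X : Type*} [TopologicalSpace X] {s A : Set X}
    (hs : IsPreconnected s) (h : Disjoint s (frontier A)) : s ⊆ A ∨ Disjoint s A := by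
  have hcover : s ⊆ interior A ∪ (closure A)ᶜ := fun x hx => by
    by_contra hx'
    simp only [Set.mem_union, Set.mem_compl_iff, not_or, not_not] at hx'
    exact Set.disjoint_left.1 h hx ⟨hx'.2, hx'.1⟩
  have hdisj : Disjoint (interior A) (closure A)ᶜ :=
    Set.disjoint_left.2 fun x hx hx' => hx' (subset_closure (interior_subset hx))
  refine (hs.subset_or_subset isOpen_interior isClosed_closure.isOpen_compl hdisj hcover).imp
    (fun hA => hA.trans interior_subset) fun hA => ?_
  exact Set.disjoint_left.2 fun x hx hxA => hA hx (subset_closure hxA)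

theorem measurableSet_of_finite_frontier {X : Type*} [TopologicalSpace X] [MeasurableSpace X]
    [OpensMeasurableSpace X] [MeasurableSingletonClass X] {A : Set X} (hA : (frontier A).Finite) :
    MeasurableSet A := by
  have : A = interior A ∪ A ∩ frontier A := by
    rw [← closure_sdiff_interior, Set.inter_sdiff_distrib_left, Set.inter_eq_left.2 subset_closure,
      Set.sdiff_self_inter, Set.union_sdiff_cancel interior_subset]
  rw [this]
  exact isOpen_interior.measurableSet.union (hA.subset Set.inter_subset_right).measurableSet

theorem abs_indicator_sub_volume_cell_le (A : Set ℝ) (k : ℤ) :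
    |A.indicator 1 (k : ℝ) - volume.real (A ∩ Set.Ico (k : ℝ) (k + 1))| ≤
      (Int.floor '' frontier A).indicator 1 k := by
  have hmem : (k : ℝ) ∈ Set.Ico (k : ℝ) (k + 1) := by simp
  have hcell : volume.real (Set.Ico (k : ℝ) (k + 1)) = 1 := by simp [Measure.real]
  have hle : volume.real (A ∩ Set.Ico (k : ℝ) (k + 1)) ≤ 1 :=
    (measureReal_mono Set.inter_subset_right (by simp)).trans hcell.le
  by_cases hk : k ∈ Int.floor '' frontier A
  · rw [Set.indicator_of_mem hk, Pi.one_apply]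
    exact abs_sub_le_of_nonneg_of_le (Set.indicator_nonneg (by simp) _)
      (Set.indicator_le_self' (by simp) _) measureReal_nonneg hle
  · have hdisj : Disjoint (Set.Ico (k : ℝ) (k + 1)) (frontier A) :=
      Set.disjoint_left.2 fun t ht htA => hk ⟨t, htA, Int.floor_eq_iff.2 ht⟩
    rw [Set.indicator_of_notMem hk]
    rcases subset_or_disjoint_of_disjoint_frontier isPreconnected_Ico hdisj with hsub | hempty
    · rw [Set.inter_eq_right.2 hsub, hcell, Set.indicator_of_mem (hsub hmem)]
      simp
    · rw [hempty.symm.inter_eq, Set.indicator_of_notMem (Set.disjoint_left.1 hempty hmem)]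
      simp

theorem volume_real_eq_sum_cells {A : Set ℝ} (hA : MeasurableSet A) {I : Finset ℤ}
    (hI : ∀ t ∈ A, ⌊t⌋ ∈ I) :
    volume.real A = ∑ k ∈ I, volume.real (A ∩ Set.Ico (k : ℝ) (k + 1)) := by
  have hcells : A = ⋃ k ∈ I, A ∩ Set.Ico (k : ℝ) (k + 1) := by
    ext t
    simp only [Set.mem_iUnion, Set.mem_inter_iff, Set.mem_Ico, exists_prop]
    exact ⟨fun h => ⟨⌊t⌋, hI t h, h, Int.floor_le t, Int.lt_floor_add_one t⟩,
      fun ⟨_, _, h, _⟩ => h⟩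
  conv_lhs => rw [hcells]
  refine measureReal_biUnion_finset (fun i _ j _ hij => ?_) (fun k _ => hA.inter measurableSet_Ico)
    fun k _ => ((measure_mono Set.inter_subset_right).trans_lt (by simp)).ne
  exact ((Set.pairwise_disjoint_Ico_intCast ℝ) hij).mono Set.inter_subset_right
    Set.inter_subset_right

theorem abs_ncard_int_sub_volume_le {A : Set ℝ} {a b : ℝ} (hAab : A ⊆ Set.Icc a b) {N : ℕ}
    (hN : (frontier A).encard ≤ N) :
    |(((↑) ⁻¹' A : Set ℤ).ncard : ℝ) - volume.real A| ≤ N := by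
  classical
  have hfin : (frontier A).Finite := Set.finite_of_encard_le_coe hN
  have hI : ∀ t ∈ A, ⌊t⌋ ∈ Finset.Icc ⌊a⌋ ⌊b⌋ := fun t ht =>
    Finset.mem_Icc.2 ⟨Int.floor_mono (hAab ht).1, Int.floor_mono (hAab ht).2⟩
  have hcount : (((↑) ⁻¹' A : Set ℤ).ncard : ℝ) =
      ∑ k ∈ Finset.Icc ⌊a⌋ ⌊b⌋, A.indicator 1 (k : ℝ) := by
    have : ((↑) ⁻¹' A : Set ℤ) = ↑((Finset.Icc ⌊a⌋ ⌊b⌋).filter fun k : ℤ => (k : ℝ) ∈ A) := by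
      ext k
      simpa using fun h : (k : ℝ) ∈ A => by simpa using hI k h
    rw [this, Set.ncard_coe_finset, Finset.natCast_card_filter]
    simp only [Set.indicator_apply, Pi.one_apply]
  rw [hcount, volume_real_eq_sum_cells (measurableSet_of_finite_frontier hfin) hI,
    ← Finset.sum_sub_distrib]
  calc _ ≤ ∑ k ∈ Finset.Icc ⌊a⌋ ⌊b⌋, (Int.floor '' frontier A).indicator (1 : ℤ → ℝ) k :=
        (Finset.abs_sum_le_sum_abs _ _).trans
          (Finset.sum_le_sum fun k _ => abs_indicator_sub_volume_cell_le A k)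
    _ = #{k ∈ Finset.Icc ⌊a⌋ ⌊b⌋ | k ∈ Int.floor '' frontier A} := by
        simp only [Finset.natCast_card_filter, Set.indicator_apply, Pi.one_apply]
    _ ≤ N := by
        rw [← Set.ncard_coe_finset]
        refine Nat.cast_le.2 ((Set.ncard_le_ncard (t := Int.floor '' frontier A)
          (fun k hk => (Finset.mem_filter.1 hk).2) (hfin.image _)).trans
          ((Set.ncard_image_le hfin).trans ?_))
        exact ENat.toNat_le_of_le_natCast hN

theorem image_preimage_mul_eq_zmultiples_inter (d : ℝ) (A : Set ℝ) :
    (fun k : ℤ => (k : ℝ) * d) '' ((↑) ⁻¹' ((· * d) ⁻¹' A)) =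
      (AddSubgroup.zmultiples d : Set ℝ) ∩ A := by
  ext t
  simp only [Set.mem_image, Set.mem_preimage, Set.mem_inter_iff, SetLike.mem_coe,
    AddSubgroup.mem_zmultiples_iff, zsmul_eq_mul]
  constructor
  · rintro ⟨k, hk, rfl⟩
    exact ⟨⟨k, rfl⟩, hk⟩
  · rintro ⟨⟨k, rfl⟩, hk⟩
    exact ⟨k, hk, rfl⟩

theorem preimage_mul_Icc {d : ℝ} (hd : 0 < d) (a b : ℝ) :
    (· * d) ⁻¹' Set.Icc a b = Set.Icc (a / d) (b / d) := by
  ext t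
  simp [div_le_iff₀ hd, le_div_iff₀ hd]

theorem ncard_zmultiples_inter {d : ℝ} (hd : 0 < d) (A : Set ℝ) :
    ((AddSubgroup.zmultiples d : Set ℝ) ∩ A).ncard =
      ((↑) ⁻¹' ((· * d) ⁻¹' A) : Set ℤ).ncard := by
  rw [← image_preimage_mul_eq_zmultiples_inter, Set.ncard_image_of_injective]
  exact fun k l h => by simpa [hd.ne'] using h

theorem finite_zmultiples_inter_Icc {d : ℝ} (hd : 0 < d) (a b : ℝ) :
    ((AddSubgroup.zmultiples d : Set ℝ) ∩ Set.Icc a b).Finite := by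
  rw [← image_preimage_mul_eq_zmultiples_inter, preimage_mul_Icc hd, Int.preimage_Icc]
  exact (Set.finite_Icc _ _).image _

theorem ncard_zmultiples_inter_Icc_le {d : ℝ} (hd : 0 < d) {a b : ℝ} (hab : a ≤ b) :
    (((AddSubgroup.zmultiples d : Set ℝ) ∩ Set.Icc a b).ncard : ℝ) ≤ (b - a) / d + 1 := by
  rw [ncard_zmultiples_inter hd, preimage_mul_Icc hd, Int.preimage_Icc, ← Finset.coe_Icc,
    Set.ncard_coe_finset, Int.card_Icc, ← Int.cast_natCast, Int.toNat_eq_max, Int.cast_max]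
  have h1 : 0 ≤ (b - a) / d := div_nonneg (by linarith) hd.le
  refine max_le ?_ (by push_cast; linarith)
  have h2 := Int.floor_le (b / d)
  have h3 := Int.le_ceil (a / d)
  push_cast
  rw [sub_div]
  linarith

theorem abs_ncard_zmultiples_inter_sub_le {d : ℝ} (hd : 0 < d) {A : Set ℝ} {a b : ℝ}
    (hAab : A ⊆ Set.Icc a b) {N : ℕ} (hN : (frontier A).encard ≤ N) :
    |(((AddSubgroup.zmultiples d : Set ℝ) ∩ A).ncard : ℝ) - volume.real A / d| ≤ N := by
  have hvol : volume.real ((· * d) ⁻¹' A) = volume.real A / d := by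
    rw [Measure.real, Real.volume_preimage_mul_right hd.ne', ENNReal.toReal_mul,
      ENNReal.toReal_ofReal (abs_nonneg _), abs_of_pos (inv_pos.2 hd), inv_mul_eq_div, Measure.real]
  have hfr : (frontier ((· * d) ⁻¹' A)).encard ≤ N := by
    have h := (Homeomorph.mulRight₀ d hd.ne').preimage_frontier A
    rw [Homeomorph.coe_mulRight₀] at h
    rw [← h]
    exact (Set.encard_preimage_of_bijective (Homeomorph.mulRight₀ d hd.ne').bijective _).trans_le hN
  rw [ncard_zmultiples_inter hd, ← hvol]
  exact abs_ncard_int_sub_volume_le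
    ((Set.preimage_mono hAab).trans (preimage_mul_Icc hd a b).le) hfr

end LatticePoints

section ProductMeasures

open MeasureTheory Finset

theorem prod_real_eq_integral {X Y : Type*} [MeasurableSpace X] [MeasurableSpace Y]
    (μ : Measure X) (ν : Measure Y) [IsFiniteMeasure μ] [IsFiniteMeasure ν] {S : Set (X × Y)}
    (hS : MeasurableSet S) : (μ.prod ν).real S = ∫ x, ν.real (Prod.mk x ⁻¹' S) ∂μ := by
  rw [Measure.real, Measure.prod_apply hS, ← integral_toReal
    (measurable_measure_prodMk_left hS).aemeasurable (by simp)]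
  rfl

theorem abs_prod_real_sub_prod_real_le {X Y : Type*} [MeasurableSpace X] [MeasurableSpace Y]
    (ρ : Measure X) (μ ν : Measure Y) [IsFiniteMeasure ρ] [IsFiniteMeasure μ] [IsFiniteMeasure ν]
    {S : Set (X × Y)} (hS : MeasurableSet S) {c : ℝ}
    (hc : ∀ x, |μ.real (Prod.mk x ⁻¹' S) - ν.real (Prod.mk x ⁻¹' S)| ≤ c) :
    |(ρ.prod μ).real S - (ρ.prod ν).real S| ≤ c * ρ.real Set.univ := by
  rw [prod_real_eq_integral ρ μ hS, prod_real_eq_integral ρ ν hS, ← integral_sub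
    (Measure.integrable_measure_prodMk_left hS (measure_ne_top _ _))
    (Measure.integrable_measure_prodMk_left hS (measure_ne_top _ _))]
  rw [← Real.norm_eq_abs]
  exact norm_integral_le_of_norm_le_const (.of_forall hc)

theorem prod_real_preimage_swap {X Y : Type*} [MeasurableSpace X] [MeasurableSpace Y]
    (μ : Measure X) (ν : Measure Y) [IsFiniteMeasure μ] [IsFiniteMeasure ν] {S : Set (X × Y)}
    (hS : MeasurableSet S) : (ν.prod μ).real (Prod.swap ⁻¹' S) = (μ.prod ν).real S := by
  rw [Measure.real, Measure.real,
    Measure.measurePreserving_swap.measure_preimage hS.nullMeasurableSet]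

theorem cons_eq_piFinSuccAbove_symm (n : ℕ) (X : Type*) [MeasurableSpace X] :
    (fun p : X × (Fin n → X) => (Fin.cons p.1 p.2 : Fin (n + 1) → X)) =
      (MeasurableEquiv.piFinSuccAbove (fun _ => X) 0).symm := by
  ext p : 1
  simp [MeasurableEquiv.piFinSuccAbove, Fin.insertNthEquiv, Fin.insertNth_zero']

theorem measurePreserving_cons {n : ℕ} {X : Type*} [MeasurableSpace X]
    (μ : Fin (n + 1) → Measure X) [∀ i, SigmaFinite (μ i)] :
    MeasurePreserving (fun p : X × (Fin n → X) => (Fin.cons p.1 p.2 : Fin (n + 1) → X))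
      ((μ 0).prod (Measure.pi fun i : Fin n => μ i.succ)) (Measure.pi μ) := by
  rw [cons_eq_piFinSuccAbove_symm]
  exact (measurePreserving_piFinSuccAbove μ 0).symm

theorem measurableEmbedding_cons (n : ℕ) (X : Type*) [MeasurableSpace X] :
    MeasurableEmbedding (fun p : X × (Fin n → X) => (Fin.cons p.1 p.2 : Fin (n + 1) → X)) := by
  rw [cons_eq_piFinSuccAbove_symm]
  exact MeasurableEquiv.measurableEmbedding _

theorem pi_real_eq_prod_real {n : ℕ} {X : Type*} [MeasurableSpace X]
    (μ : Fin (n + 1) → Measure X) [∀ i, SigmaFinite (μ i)] {S : Set (Fin (n + 1) → X)}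
    (hS : MeasurableSet S) :
    (Measure.pi μ).real S = ((μ 0).prod (Measure.pi fun i : Fin n => μ i.succ)).real
      ((fun p : X × (Fin n → X) => (Fin.cons p.1 p.2 : Fin (n + 1) → X)) ⁻¹' S) :=
  congrArg ENNReal.toReal ((measurePreserving_cons μ).measure_preimage hS.nullMeasurableSet).symm

theorem update_cons_succ_preimage {n : ℕ} {X : Type*} (a : X) (y : Fin n → X) (i : Fin n)
    (S : Set (Fin (n + 1) → X)) :
    Function.update (Fin.cons a y : Fin (n + 1) → X) i.succ ⁻¹' S =
      Function.update y i ⁻¹' ((fun z => (Fin.cons a z : Fin (n + 1) → X)) ⁻¹' S) := by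
  ext t
  simp only [Set.mem_preimage, Fin.cons_update]

theorem update_cons_zero_preimage {n : ℕ} {X : Type*} (a : X) (y : Fin n → X)
    (S : Set (Fin (n + 1) → X)) :
    Function.update (Fin.cons a y : Fin (n + 1) → X) 0 ⁻¹' S =
      (fun t => (Fin.cons t y : Fin (n + 1) → X)) ⁻¹' S := by
  ext t
  simp only [Set.mem_preimage, Fin.update_cons_zero]

theorem sum_prod_erase_succ {R : Type*} [CommSemiring R] {n : ℕ} (f : Fin (n + 1) → R) :
    ∑ k, ∏ j ∈ univ.erase k, f j =
      ∏ j : Fin n, f j.succ + f 0 * ∑ k : Fin n, ∏ j ∈ univ.erase k, f j.succ := by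
  have h0 : univ.erase (0 : Fin (n + 1)) = univ.map (Fin.succEmb n) := by
    rw [Fin.univ_succ, erase_cons]; rfl
  have hs (k : Fin n) : univ.erase k.succ =
      cons 0 ((univ.erase k).map (Fin.succEmb n)) (by simp) := by
    ext j
    refine Fin.cases ?_ (fun i => ?_) j <;> simp [Fin.succ_ne_zero, (Fin.succ_ne_zero _).symm]
  rw [Fin.sum_univ_succ, h0, prod_map, mul_sum]
  simp only [hs, prod_cons, prod_map, Fin.coe_succEmb]

theorem abs_pi_real_sub_pi_real_le {n : ℕ} {X : Type*} [Nonempty X] [MeasurableSpace X]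
    (μ ν : Fin n → Measure X) [∀ i, IsFiniteMeasure (μ i)] [∀ i, IsFiniteMeasure (ν i)]
    {S : Set (Fin n → X)} (hS : MeasurableSet S) {c : ℝ} (hc : 0 ≤ c)
    (hline : ∀ x i, |(μ i).real (Function.update x i ⁻¹' S) -
      (ν i).real (Function.update x i ⁻¹' S)| ≤ c)
    {B : Fin n → ℝ} (hμ : ∀ i, (μ i).real Set.univ ≤ B i) (hν : ∀ i, (ν i).real Set.univ ≤ B i) :
    |(Measure.pi μ).real S - (Measure.pi ν).real S| ≤ c * ∑ k, ∏ j ∈ univ.erase k, B j := by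
  obtain ⟨x₀⟩ := ‹Nonempty X›
  induction n with
  | zero => simp [Measure.pi_of_empty μ, Measure.pi_of_empty ν]
  | succ n ih =>
    set μ' := fun i : Fin n => μ i.succ
    set ν' := fun i : Fin n => ν i.succ
    set T := (fun p : X × (Fin n → X) => (Fin.cons p.1 p.2 : Fin (n + 1) → X)) ⁻¹' S
    have hT : MeasurableSet T := (measurableEmbedding_cons n X).measurable hS
    have hBpos : 0 ≤ ∑ k : Fin n, ∏ j ∈ univ.erase k, B j.succ :=
      sum_nonneg fun k _ => prod_nonneg fun j _ => measureReal_nonneg.trans (hμ j.succ)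
    have hfirst : |((μ 0).prod (Measure.pi μ')).real T - ((μ 0).prod (Measure.pi ν')).real T| ≤
        c * (∑ k : Fin n, ∏ j ∈ univ.erase k, B j.succ) * B 0 := by
      refine (abs_prod_real_sub_prod_real_le _ _ _ hT fun a => ?_).trans
        (mul_le_mul_of_nonneg_left (hμ 0) (mul_nonneg hc hBpos))
      refine ih μ' ν' (measurable_prodMk_left hT) (fun y i => ?_) (fun i => hμ i.succ)
        fun i => hν i.succ
      exact update_cons_succ_preimage a y i S ▸ hline (Fin.cons a y) i.succ
    have hrest : |((μ 0).prod (Measure.pi ν')).real T - ((ν 0).prod (Measure.pi ν')).real T| ≤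
        c * ∏ i : Fin n, B i.succ := by
      rw [← prod_real_preimage_swap _ _ hT, ← prod_real_preimage_swap _ _ hT]
      refine (abs_prod_real_sub_prod_real_le _ _ _ (measurable_swap hT) fun y => ?_).trans
        (mul_le_mul_of_nonneg_left ?_ hc)
      · exact update_cons_zero_preimage x₀ y S ▸ hline (Fin.cons x₀ y) 0
      · rw [Measure.real, Measure.pi_univ, ENNReal.toReal_prod]
        exact prod_le_prod (fun _ _ => measureReal_nonneg) fun i _ => hν i.succ
    rw [pi_real_eq_prod_real μ hS, pi_real_eq_prod_real ν hS, sum_prod_erase_succ]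
    refine (abs_sub_le _ (((μ 0).prod (Measure.pi ν')).real T) _).trans ?_
    linarith

theorem isFiniteMeasure_count_restrict {X : Type*} [MeasurableSpace X] [MeasurableSingletonClass X]
    {F : Set X} (hF : F.Finite) : IsFiniteMeasure (Measure.count.restrict F) :=
  ⟨by simpa using Measure.count_apply_lt_top.2 hF⟩

theorem count_restrict_real {X : Type*} [MeasurableSpace X] [MeasurableSingletonClass X]
    {F : Set X} (hF : F.Finite) (A : Set X) :
    (Measure.count.restrict F).real A = (F ∩ A).ncard := by
  have hfin := hF.inter_of_left A
  rw [measureReal_restrict_apply' hF.measurableSet, Set.inter_comm, Measure.real,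
    Measure.count_apply_finite _ hfin, ENNReal.toReal_natCast, Set.ncard_eq_toFinset_card _ hfin]

theorem pi_count_restrict_real {ι X : Type*} [Fintype ι] [MeasurableSpace X]
    [MeasurableSingletonClass X] {F : ι → Set X} (hF : ∀ i, (F i).Finite) (S : Set (ι → X)) :
    (Measure.pi fun i => Measure.count.restrict (F i)).real S = (Set.univ.pi F ∩ S).ncard := by
  have (i : ι) := isFiniteMeasure_count_restrict (hF i)
  have hpi : (Set.univ.pi F).Finite := Set.Finite.pi hF
  have hnull : Measure.pi (fun i => Measure.count.restrict (F i)) (Set.univ.pi F)ᶜ = 0 := by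
    have hmem : ∀ᵐ x ∂Measure.pi fun i => Measure.count.restrict (F i), ∀ i, x i ∈ F i :=
      Filter.eventually_all.2 fun i =>
        Measure.tendsto_eval_ae_ae.eventually (ae_restrict_mem (hF i).measurableSet)
    simpa [ae_iff, Set.pi, Set.compl_ofPred] using hmem
  have hsingle : ∀ x ∈ (hpi.inter_of_left S).toFinset,
      Measure.pi (fun i => Measure.count.restrict (F i)) {x} = 1 := fun x hx => by
    simp only [Set.Finite.mem_toFinset, Set.mem_inter_iff, Set.mem_univ_pi] at hx
    rw [Measure.pi_singleton]
    refine Finset.prod_eq_one fun i _ => ?_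
    rw [Measure.restrict_apply (measurableSet_singleton _),
      Set.inter_eq_left.2 (Set.singleton_subset_iff.2 (hx.1 i)), Measure.count_singleton]
  rw [Measure.real, ← measure_inter_conull hnull, Set.inter_comm,
    ← (hpi.inter_of_left S).coe_toFinset, ← sum_measure_singleton, Finset.sum_congr rfl hsingle,
    Finset.sum_const, nsmul_one, ENNReal.toReal_natCast, Set.ncard_coe_finset]

theorem pi_smul_measure {ι : Type*} [Fintype ι] {X : ι → Type*} [∀ i, MeasurableSpace (X i)]
    (c : ι → NNReal) (μ : ∀ i, Measure (X i)) [∀ i, SigmaFinite (μ i)] :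
    (Measure.pi fun i => c i • μ i) = (∏ i, c i) • Measure.pi μ := by
  refine Measure.pi_eq fun s _ => ?_
  simp only [Measure.smul_apply, Measure.pi_pi, ENNReal.smul_def, smul_eq_mul, prod_mul_distrib,
    ENNReal.ofNNReal_finsetProd]

end ProductMeasures

section DiagonalLattices

open MeasureTheory Finset

theorem closure_range_single {ι : Type*} [Finite ι] [DecidableEq ι] {G : ι → Type*}
    [∀ i, AddCommGroup (G i)] (d : ∀ i, G i) :
    AddSubgroup.closure (Set.range fun i => Pi.single i (d i)) =
      AddSubgroup.pi Set.univ fun i => AddSubgroup.zmultiples (d i) := by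
  refine le_antisymm ((AddSubgroup.closure_le _).2 ?_) (AddSubgroup.pi_le_iff.2 fun i => ?_)
  · rintro _ ⟨i, rfl⟩
    exact AddSubgroup.single_mem_pi _ _ |>.2 fun _ => AddSubgroup.mem_zmultiples _
  · rw [AddMonoidHom.map_zmultiples, AddSubgroup.zmultiples_le]
    exact AddSubgroup.subset_closure ⟨i, rfl⟩

theorem finite_diagonal_lattice_inter {ι : Type*} [Finite ι] [DecidableEq ι] {d : ι → ℝ}
    (hd : ∀ i, 0 < d i) {S : Set (ι → ℝ)} {a b : ι → ℝ} (hSab : S ⊆ Set.Icc a b) :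
    ((AddSubgroup.closure (Set.range fun i => Pi.single i (d i)) : Set (ι → ℝ)) ∩ S).Finite := by
  refine (Set.Finite.pi fun i => finite_zmultiples_inter_Icc (hd i) (a i) (b i)).subset ?_
  rw [closure_range_single, AddSubgroup.coe_pi, Set.pi_inter_distrib, Set.pi_univ_Icc]
  exact Set.inter_subset_inter_right _ hSab

theorem abs_ncard_diagonal_lattice_inter_sub_le {n : ℕ} {d : Fin n → ℝ} (hd : ∀ i, 0 < d i)
    {S : Set (Fin n → ℝ)} (hS : MeasurableSet S) {a b : Fin n → ℝ} (hab : a ≤ b)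
    (hSab : S ⊆ Set.Icc a b) {N : ℕ}
    (hline : ∀ x i, (frontier (Function.update x i ⁻¹' S)).encard ≤ N) :
    |(((AddSubgroup.closure (Set.range fun i => Pi.single i (d i)) : Set (Fin n → ℝ)) ∩
        S).ncard : ℝ) - volume.real S / ∏ i, d i| ≤
      N * ∑ k, ∏ j ∈ univ.erase k, ((b j - a j) / d j + 1) := by
  set F : Fin n → Set ℝ := fun i => AddSubgroup.zmultiples (d i) ∩ Set.Icc (a i) (b i)
  have hF (i : Fin n) : (F i).Finite := finite_zmultiples_inter_Icc (hd i) _ _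
  set μ : Fin n → Measure ℝ := fun i => Measure.count.restrict (F i)
  set ν : Fin n → Measure ℝ := fun i =>
    (d i)⁻¹.toNNReal • volume.restrict (Set.Icc (a i) (b i))
  have (i : Fin n) : IsFiniteMeasure (μ i) := isFiniteMeasure_count_restrict (hF i)
  have hν (i : Fin n) (A : Set ℝ) : (ν i).real A = volume.real (A ∩ Set.Icc (a i) (b i)) / d i := by
    rw [measureReal_nnreal_smul_apply, measureReal_restrict_apply' measurableSet_Icc,
      Real.coe_toNNReal _ (inv_pos.2 (hd i)).le, inv_mul_eq_div]
  have hpiμ : (Measure.pi μ).real S = ((AddSubgroup.closure (Set.range fun i => Pi.single i (d i)) :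
      Set (Fin n → ℝ)) ∩ S).ncard := by
    rw [pi_count_restrict_real hF, closure_range_single, AddSubgroup.coe_pi, Set.pi_inter_distrib,
      Set.pi_univ_Icc, Set.inter_assoc, Set.inter_eq_right.2 hSab]
  have hpiν : (Measure.pi ν).real S = volume.real S / ∏ i, d i := by
    rw [pi_smul_measure, measureReal_nnreal_smul_apply, ← Measure.restrict_pi_pi, Set.pi_univ_Icc,
      measureReal_restrict_apply hS, Set.inter_eq_left.2 hSab]
    simp only [NNReal.coe_prod, Real.coe_toNNReal _ (inv_pos.2 (hd _)).le, Finset.prod_inv_distrib,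
      inv_mul_eq_div, volume_pi]
  have hsection (x : Fin n → ℝ) (i : Fin n) :
      Function.update x i ⁻¹' S ⊆ Set.Icc (a i) (b i) := fun t ht => by
    simpa using And.intro ((hSab ht).1 i) ((hSab ht).2 i)
  rw [← hpiμ, ← hpiν]
  refine abs_pi_real_sub_pi_real_le μ ν hS N.cast_nonneg (fun x i => ?_) (fun i => ?_) fun i => ?_
  · rw [count_restrict_real (hF i), hν, Set.inter_eq_left.2 (hsection x i), Set.inter_assoc,
      Set.inter_eq_right.2 (hsection x i)]
    exact abs_ncard_zmultiples_inter_sub_le (hd i) (hsection x i) (hline x i)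
  · rw [count_restrict_real (hF i), Set.inter_univ]
    exact ncard_zmultiples_inter_Icc_le (hd i) (hab i)
  · rw [hν, Set.univ_inter, Real.volume_real_Icc_of_le (hab i)]
    linarith

end DiagonalLattices

section AbsVandermonde

open MeasureTheory Finset

/-- The absolute value of the Vandermonde determinant of `x`: the Jacobian of the map from roots to
coefficients. -/
noncomputable def absVandermonde {n : ℕ} (x : Fin n → ℝ) : ℝ := |(Matrix.vandermonde x).det|

theorem absVandermonde_nonneg {n : ℕ} (x : Fin n → ℝ) : 0 ≤ absVandermonde x := abs_nonneg _

@[fun_prop]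
theorem continuous_absVandermonde {n : ℕ} : Continuous (absVandermonde (n := n)) := by
  unfold absVandermonde
  simp only [Matrix.det_vandermonde]
  fun_prop

theorem absVandermonde_comp_perm {n : ℕ} (σ : Equiv.Perm (Fin n)) (x : Fin n → ℝ) :
    absVandermonde (x ∘ σ) = absVandermonde x := by
  have hperm : Matrix.vandermonde (x ∘ σ) = (Matrix.vandermonde x).submatrix σ id := rfl
  rw [absVandermonde, hperm, Matrix.det_permute, abs_mul, absVandermonde]
  rcases Int.units_eq_one_or (Equiv.Perm.sign σ) with h | h <;> simp [h]

theorem absVandermonde_eq_zero_iff {n : ℕ} {x : Fin n → ℝ} :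
    absVandermonde x = 0 ↔ ¬ Function.Injective x := by
  rw [absVandermonde, abs_eq_zero, ← not_iff_not, not_not, ← Matrix.det_vandermonde_ne_zero_iff]

theorem absVandermonde_cons {n : ℕ} (t : ℝ) (y : Fin n → ℝ) :
    absVandermonde (Fin.cons t y : Fin (n + 1) → ℝ) = (∏ j, |y j - t|) * absVandermonde y := by
  simp only [absVandermonde, Matrix.det_vandermonde, Fin.prod_univ_succ, abs_mul, abs_prod,
    Fin.prod_Ioi_zero, Fin.prod_Ioi_succ, Fin.cons_zero, Fin.cons_succ]

end AbsVandermonde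

section Permutations

open MeasureTheory Finset

theorem measurePreserving_comp_perm {ι X : Type*} [Fintype ι] [MeasurableSpace X] (μ : Measure X)
    [SigmaFinite μ] (σ : Equiv.Perm ι) :
    MeasurePreserving (fun x : ι → X => x ∘ σ) (.pi fun _ => μ) (.pi fun _ => μ) :=
  measurePreserving_arrowCongr' (fun _ => μ) (fun _ => μ) σ.symm (.refl X) fun _ => .id μ

theorem measurableEmbedding_comp_perm {ι X : Type*} [MeasurableSpace X] (σ : Equiv.Perm ι) :
    MeasurableEmbedding fun x : ι → X => x ∘ σ :=
  (MeasurableEquiv.arrowCongr' σ.symm (.refl X)).measurableEmbedding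

theorem exists_perm_map_eq {α : Type*} [Finite α] {s t : Finset α} (h : #s = #t) :
    ∃ σ : Equiv.Perm α, s.map σ.toEmbedding = t := by
  classical
  have := Fintype.ofFinite α
  refine ⟨(Finset.equivOfCardEq h).extendSubtype, eq_of_subset_of_card_le ?_ (by simp [h])⟩
  intro j hj
  obtain ⟨i, hi, rfl⟩ := mem_map.1 hj
  exact Equiv.extendSubtype_mem _ i hi

theorem prod_comp_swap {α M : Type*} [DecidableEq α] [CommMonoid M] {s : Finset α} {i j : α}
    (h : i ∈ s ↔ j ∈ s) (f : α → M) : ∏ k ∈ s, f (Equiv.swap i j k) = ∏ k ∈ s, f k := by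
  refine prod_equiv (Equiv.swap i j) (fun k => ?_) fun _ _ => rfl
  rw [Equiv.swap_apply_def]
  split_ifs <;> simp_all

end Permutations

section IntegrationByParts

open MeasureTheory Finset

variable {a b : ℝ} {n : ℕ}

/-- Lebesgue measure on the cube `[a, b]ⁿ`, as a product measure. -/
noncomputable def cubeMeasure (a b : ℝ) (n : ℕ) : Measure (Fin n → ℝ) :=
  Measure.pi fun _ => volume.restrict (Set.Icc a b)

theorem cubeMeasure_eq_restrict :
    cubeMeasure a b n = volume.restrict (Set.univ.pi fun _ : Fin n => Set.Icc a b) := by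
  rw [cubeMeasure, volume_pi, Measure.restrict_pi_pi]

theorem integrable_cubeMeasure_of_continuous {f : (Fin n → ℝ) → ℝ} (hf : Continuous f) :
    Integrable f (cubeMeasure a b n) := by
  rw [cubeMeasure_eq_restrict]
  exact hf.continuousOn.integrableOn_compact (isCompact_univ_pi fun _ => isCompact_Icc)

theorem integral_cubeMeasure_comp_perm (σ : Equiv.Perm (Fin n)) (f : (Fin n → ℝ) → ℝ) :
    ∫ x, f (x ∘ σ) ∂cubeMeasure a b n = ∫ x, f x ∂cubeMeasure a b n :=
  (measurePreserving_comp_perm _ σ).integral_comp (measurableEmbedding_comp_perm σ) f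

theorem integrable_cubeMeasure_comp_perm (σ : Equiv.Perm (Fin n)) {f : (Fin n → ℝ) → ℝ} :
    Integrable (fun x => f (x ∘ σ)) (cubeMeasure a b n) ↔ Integrable f (cubeMeasure a b n) :=
  (measurePreserving_comp_perm _ σ).integrable_comp_emb (measurableEmbedding_comp_perm σ)

theorem integral_cubeMeasure_succ {G : (Fin (n + 1) → ℝ) → ℝ}
    (hG : Integrable G (cubeMeasure a b (n + 1))) :
    (∀ᵐ y ∂cubeMeasure a b n, IntegrableOn (fun t => G (Fin.cons t y)) (Set.Icc a b)) ∧
      ∫ x, G x ∂cubeMeasure a b (n + 1) =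
        ∫ y, (∫ t in Set.Icc a b, G (Fin.cons t y)) ∂cubeMeasure a b n := by
  have hmp := measurePreserving_cons fun _ : Fin (n + 1) => volume.restrict (Set.Icc a b)
  have hG' := (hmp.integrable_comp_emb (measurableEmbedding_cons n ℝ)).2 hG
  refine ⟨hG'.prod_left_ae, ?_⟩
  rw [cubeMeasure, ← hmp.integral_comp (measurableEmbedding_cons n ℝ)]
  exact integral_prod_symm _ hG'

theorem hasDerivAt_abs_sub {c t : ℝ} (h : c ≠ t) :
    HasDerivAt (fun t => |c - t|) ((t - c)⁻¹ * |c - t|) t := by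
  have hne : c - t ≠ 0 := sub_ne_zero.2 h
  refine ((hasDerivAt_abs hne).comp t ((hasDerivAt_id t).const_sub c)).congr_deriv ?_
  rw [← neg_sub c t, inv_neg, ← self_mul_sign (c - t), neg_mul, inv_mul_cancel_left₀ hne,
    mul_neg_one]

theorem hasDerivAt_prod_abs_sub (y : Fin n → ℝ) {t : ℝ} (ht : ∀ j, y j ≠ t) :
    HasDerivAt (fun t => ∏ j, |y j - t|) ((∑ j, (t - y j)⁻¹) * ∏ j, |y j - t|) t := by
  refine (HasDerivAt.fun_finsetProd fun j _ => hasDerivAt_abs_sub (ht j)).congr_deriv ?_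
  rw [sum_mul]
  refine sum_congr rfl fun j hj => ?_
  rw [← mul_prod_erase univ _ hj, smul_eq_mul]
  ring

theorem setIntegral_deriv_mul_prod_abs_sub (hab : a ≤ b) {f f' : ℝ → ℝ}
    (hf : ∀ t, HasDerivAt f (f' t) t) (y : Fin n → ℝ)
    (hint : IntegrableOn (fun t => (f' t + f t * ∑ j, (t - y j)⁻¹) * ∏ j, |y j - t|)
      (Set.Icc a b)) :
    ∫ t in Set.Icc a b, (f' t + f t * ∑ j, (t - y j)⁻¹) * ∏ j, |y j - t| =
      f b * ∏ j, |y j - b| - f a * ∏ j, |y j - a| := by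
  have hfc : Continuous f := continuous_iff_continuousAt.2 fun t => (hf t).continuousAt
  have hderiv : ∀ t ∈ Set.Ioo a b \ Set.range y, HasDerivAt (fun t => f t * ∏ j, |y j - t|)
      ((f' t + f t * ∑ j, (t - y j)⁻¹) * ∏ j, |y j - t|) t := fun t ht =>
    ((hf t).mul (hasDerivAt_prod_abs_sub y fun j h => ht.2 ⟨j, h⟩)).congr_deriv (by ring)
  rw [integral_Icc_eq_integral_Ioc, ← intervalIntegral.integral_of_le hab]
  exact integral_eq_of_hasDerivAt_off_countable_of_le _ _ hab (Set.finite_range y).countable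
    (by fun_prop) hderiv ((intervalIntegrable_iff_integrableOn_Icc_of_le hab).2 hint)

theorem inv_sub_mul_absVandermonde_le (x : Fin (n + 1) → ℝ) (j : Fin n) :
    |(x 0 - x j.succ)⁻¹ * absVandermonde x| ≤
      (∏ i ∈ univ.erase j, |x i.succ - x 0|) * absVandermonde (Fin.tail x) := by
  have hx : absVandermonde x = |x j.succ - x 0| *
      ((∏ i ∈ univ.erase j, |x i.succ - x 0|) * absVandermonde (Fin.tail x)) := by
    rw [← mul_assoc, mul_prod_erase univ (fun i : Fin n => |x i.succ - x 0|) (mem_univ j)]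
    exact (congrArg absVandermonde (Fin.cons_self_tail x)).symm.trans (absVandermonde_cons _ _)
  rw [abs_mul, abs_of_nonneg (absVandermonde_nonneg x), hx, abs_inv, abs_sub_comm, ← mul_assoc]
  exact mul_le_of_le_one_left (mul_nonneg (prod_nonneg fun _ _ => abs_nonneg _)
    (absVandermonde_nonneg _)) inv_mul_le_one

theorem integrable_mul_inv_sub_mul_absVandermonde {P : (Fin (n + 1) → ℝ) → ℝ}
    (hP : Continuous P) (j : Fin n) : Integrable
      (fun x => P x * ((x 0 - x j.succ)⁻¹ * absVandermonde x)) (cubeMeasure a b (n + 1)) := by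
  have : Continuous fun x : Fin (n + 1) → ℝ => absVandermonde (Fin.tail x) :=
    continuous_absVandermonde.comp (by unfold Fin.tail; fun_prop)
  have hbound : Continuous fun x : Fin (n + 1) → ℝ =>
      |P x| * ((∏ i ∈ univ.erase j, |x i.succ - x 0|) * absVandermonde (Fin.tail x)) := by
    fun_prop
  refine (integrable_cubeMeasure_of_continuous hbound).mono' ?_ (.of_forall fun x => ?_)
  · have hΔ := (continuous_absVandermonde (n := n + 1)).measurable
    have hPm := hP.measurable
    exact Measurable.aestronglyMeasurable (by fun_prop)
  · rw [Real.norm_eq_abs, abs_mul]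
    exact mul_le_mul_of_nonneg_left (inv_sub_mul_absVandermonde_le x j) (abs_nonneg _)

theorem integral_deriv_mul_absVandermonde (hab : a ≤ b) {f f' : ℝ → ℝ}
    (hf : ∀ t, HasDerivAt f (f' t) t) (hf' : Continuous f') {Q : (Fin n → ℝ) → ℝ}
    (hQ : Continuous Q) :
    ∫ x : Fin (n + 1) → ℝ, f' (x 0) * Q (Fin.tail x) * absVandermonde x ∂cubeMeasure a b (n + 1) +
        ∑ j : Fin n, ∫ x : Fin (n + 1) → ℝ, f (x 0) * Q (Fin.tail x) *
          ((x 0 - x j.succ)⁻¹ * absVandermonde x) ∂cubeMeasure a b (n + 1) =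
      ∫ y, (f b * ∏ j, |y j - b| - f a * ∏ j, |y j - a|) * (Q y * absVandermonde y)
        ∂cubeMeasure a b n := by
  have hfc : Continuous f := continuous_iff_continuousAt.2 fun t => (hf t).continuousAt
  have : Continuous fun x : Fin (n + 1) → ℝ => Q (Fin.tail x) :=
    hQ.comp (by unfold Fin.tail; fun_prop)
  have hint₁ : Integrable (fun x : Fin (n + 1) → ℝ => f' (x 0) * Q (Fin.tail x) * absVandermonde x)
      (cubeMeasure a b (n + 1)) := integrable_cubeMeasure_of_continuous (by fun_prop)
  have hint₂ (j : Fin n) := integrable_mul_inv_sub_mul_absVandermonde (a := a) (b := b)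
    (P := fun x : Fin (n + 1) → ℝ => f (x 0) * Q (Fin.tail x)) (by fun_prop) j
  rw [← integral_finsetSum _ fun j _ => hint₂ j,
    ← integral_add hint₁ (integrable_finsetSum _ fun j _ => hint₂ j)]
  have hcons (t : ℝ) (y : Fin n → ℝ) : f' t * Q y * ((∏ j, |y j - t|) * absVandermonde y) +
      ∑ j, f t * Q y * ((t - y j)⁻¹ * ((∏ j, |y j - t|) * absVandermonde y)) =
      (f' t + f t * ∑ j, (t - y j)⁻¹) * (∏ j, |y j - t|) * (Q y * absVandermonde y) := by
    simp only [← mul_sum, ← sum_mul]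
    ring
  obtain ⟨hae, hfubini⟩ := integral_cubeMeasure_succ
    (hint₁.add (integrable_finsetSum univ fun j _ => hint₂ j))
  simp only [Pi.add_apply, Fin.cons_zero, Fin.cons_succ, Fin.tail_cons, absVandermonde_cons,
    hcons] at hae hfubini
  refine hfubini.trans (integral_congr_ae ?_)
  filter_upwards [hae] with y hy
  rw [integral_mul_const]
  by_cases h0 : Q y * absVandermonde y = 0
  · simp only [h0, mul_zero]
  · rw [setIntegral_deriv_mul_prod_abs_sub hab hf y
      ((integrable_mul_const_iff (isUnit_iff_ne_zero.2 h0) _).1 hy)]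

theorem two_mul_integral_eq_of_symmetrization (σ : Equiv.Perm (Fin n))
    {F H : (Fin n → ℝ) → ℝ} (hF : Integrable F (cubeMeasure a b n))
    (h : ∀ x, F x + F (x ∘ σ) = H x) :
    2 * ∫ x, F x ∂cubeMeasure a b n = ∫ x, H x ∂cubeMeasure a b n := by
  simp_rw [two_mul, ← h]
  rw [integral_add hF ((integrable_cubeMeasure_comp_perm σ).2 hF), integral_cubeMeasure_comp_perm]

theorem two_mul_integral_mul_inv_sub_mul_absVandermonde {P R : (Fin (n + 1) → ℝ) → ℝ}
    (hP : Continuous P) (j : Fin n)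
    (h : ∀ x, P x - P (x ∘ Equiv.swap 0 j.succ) = (x 0 - x j.succ) * R x) :
    2 * ∫ x, P x * ((x 0 - x j.succ)⁻¹ * absVandermonde x) ∂cubeMeasure a b (n + 1) =
      ∫ x, R x * absVandermonde x ∂cubeMeasure a b (n + 1) := by
  refine two_mul_integral_eq_of_symmetrization (Equiv.swap 0 j.succ)
    (integrable_mul_inv_sub_mul_absVandermonde hP j) fun x => ?_
  simp only [absVandermonde_comp_perm, Function.comp_apply, Equiv.swap_apply_left,
    Equiv.swap_apply_right]
  rw [← neg_sub (x 0) (x j.succ), inv_neg]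
  rcases eq_or_ne (x 0) (x j.succ) with hx | hx
  · rw [absVandermonde_eq_zero_iff.2 fun hinj => (Fin.succ_ne_zero j).symm (hinj hx)]
    simp only [mul_zero, add_zero]
  · calc _ = (P x - P (x ∘ Equiv.swap 0 j.succ)) * (x 0 - x j.succ)⁻¹ * absVandermonde x := by ring
      _ = _ := by rw [h, mul_right_comm _ _ (_)⁻¹, mul_inv_cancel₀ (sub_ne_zero.2 hx), one_mul]

end IntegrationByParts

section VandermondeMoments

open MeasureTheory Finset

variable {a b : ℝ} {n : ℕ}

/-- The moment `∫ ∏_{i ∈ s} (xᵢ - a) |Δ(x)| dx` over the cube `[a, b]ⁿ`, an Aomoto-type extension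
of Selberg's integral. -/
noncomputable def vandermondeMoment (a b : ℝ) (s : Finset (Fin n)) : ℝ :=
  ∫ x, (∏ i ∈ s, (x i - a)) * absVandermonde x ∂cubeMeasure a b n

theorem vandermondeMoment_empty :
    vandermondeMoment a b (∅ : Finset (Fin n)) = ∫ x, absVandermonde x ∂cubeMeasure a b n := by
  simp only [vandermondeMoment, prod_empty, one_mul]

theorem vandermondeMoment_eq_of_card_eq {s t : Finset (Fin n)} (h : #s = #t) :
    vandermondeMoment a b s = vandermondeMoment a b t := by
  obtain ⟨σ, rfl⟩ := exists_perm_map_eq h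
  rw [vandermondeMoment, vandermondeMoment, ← integral_cubeMeasure_comp_perm σ]
  simp only [absVandermonde_comp_perm, prod_map, Equiv.coe_toEmbedding, Function.comp_apply]

theorem two_mul_integral_of_mem {s : Finset (Fin (n + 1))} {j : Fin n} (h0 : 0 ∈ s)
    (hj : j.succ ∈ s) :
    2 * ∫ x, (b - x 0) * (∏ i ∈ s, (x i - a)) * ((x 0 - x j.succ)⁻¹ * absVandermonde x)
      ∂cubeMeasure a b (n + 1) = -vandermondeMoment a b s := by
  rw [vandermondeMoment, ← integral_neg]
  simp only [← neg_mul]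
  refine two_mul_integral_mul_inv_sub_mul_absVandermonde (by fun_prop) j fun x => ?_
  simp only [Function.comp_apply, Equiv.swap_apply_left,
    prod_comp_swap (iff_of_true h0 hj) fun i => x i - a]
  ring

theorem two_mul_integral_of_notMem {s : Finset (Fin (n + 1))} {j : Fin n} (h0 : 0 ∉ s)
    (hj : j.succ ∉ s) :
    2 * ∫ x, (b - x 0) * (∏ i ∈ insert 0 s, (x i - a)) *
      ((x 0 - x j.succ)⁻¹ * absVandermonde x) ∂cubeMeasure a b (n + 1) =
      (b - a) * vandermondeMoment a b s - 2 * vandermondeMoment a b (insert 0 s) := by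
  have hcard : vandermondeMoment a b (insert j.succ s) = vandermondeMoment a b (insert 0 s) :=
    vandermondeMoment_eq_of_card_eq (by rw [card_insert_of_notMem h0, card_insert_of_notMem hj])
  calc _ = ∫ x, ((a + b - x 0 - x j.succ) * ∏ i ∈ s, (x i - a)) * absVandermonde x
        ∂cubeMeasure a b (n + 1) := by
        refine two_mul_integral_mul_inv_sub_mul_absVandermonde (by fun_prop) j fun x => ?_
        simp only [prod_insert h0, Function.comp_apply, Equiv.swap_apply_left,
          prod_comp_swap (iff_of_false h0 hj) fun i => x i - a]
        ring
    _ = (b - a) * vandermondeMoment a b s - vandermondeMoment a b (insert 0 s) -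
        vandermondeMoment a b (insert j.succ s) := by
        simp only [vandermondeMoment, prod_insert h0, prod_insert hj]
        rw [← integral_const_mul, ← integral_sub, ← integral_sub]
        · congr with x
          ring
        all_goals exact integrable_cubeMeasure_of_continuous (by fun_prop)
    _ = _ := by rw [hcard]; ring

theorem integral_add_sub_two_mul_mul (s : Finset (Fin (n + 1))) (h0 : 0 ∉ s) :
    ∫ x, (a + b - 2 * x 0) * (∏ i ∈ s, (x i - a)) * absVandermonde x ∂cubeMeasure a b (n + 1) =
      (b - a) * vandermondeMoment a b s - 2 * vandermondeMoment a b (insert 0 s) := by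
  simp only [vandermondeMoment, prod_insert h0]
  rw [← integral_const_mul, ← integral_const_mul, ← integral_sub]
  · congr with x
    ring
  all_goals exact integrable_cubeMeasure_of_continuous (by fun_prop)

theorem vandermondeMoment_insert_zero (hab : a ≤ b) (s : Finset (Fin n)) :
    (2 * n - #s + 4) * vandermondeMoment a b (insert 0 (s.map (Fin.succEmb n))) =
      (b - a) * (n - #s + 2) * vandermondeMoment a b (s.map (Fin.succEmb n)) := by
  set t := s.map (Fin.succEmb n) with ht
  have h0 : 0 ∉ t := by simp [ht, Fin.succ_ne_zero]
  have hparts : ∫ x, (a + b - 2 * x 0) * (∏ i ∈ t, (x i - a)) * absVandermonde x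
      ∂cubeMeasure a b (n + 1) + ∑ j : Fin n, ∫ x, (b - x 0) * (∏ i ∈ insert 0 t, (x i - a)) *
        ((x 0 - x j.succ)⁻¹ * absVandermonde x) ∂cubeMeasure a b (n + 1) = 0 := by
    have hderiv (t : ℝ) : HasDerivAt (fun t => (b - t) * (t - a)) (a + b - 2 * t) t :=
      (((hasDerivAt_id t).const_sub b).mul ((hasDerivAt_id t).sub_const a)).congr_deriv
        (by simp only [id]; ring)
    simpa [prod_insert h0, ht, Fin.tail, mul_assoc] using
      integral_deriv_mul_absVandermonde hab hderiv (by fun_prop)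
        (Q := fun y => ∏ i ∈ s, (y i - a)) (by fun_prop)
  have hmem : ∀ j ∈ s, _ := fun j hj => two_mul_integral_of_mem (a := a) (b := b)
    (mem_insert_self 0 t) (mem_insert_of_mem (mem_map_of_mem (Fin.succEmb n) hj))
  have hnotMem : ∀ j ∈ sᶜ, _ := fun j hj => two_mul_integral_of_notMem (a := a) (b := b) (j := j) h0
    (by simpa [ht] using hj)
  rw [integral_add_sub_two_mul_mul t h0] at hparts
  have hsum := congrArg (2 * ·) hparts
  simp only [mul_add, mul_sum, ← sum_add_sum_compl s] at hsum
  rw [sum_congr rfl hmem, sum_congr rfl hnotMem, sum_const, sum_const, nsmul_eq_mul, nsmul_eq_mul,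
    card_compl, Nat.cast_sub (card_le_univ s), Fintype.card_fin] at hsum
  linarith

theorem vandermondeMoment_insert (hab : a ≤ b) {s : Finset (Fin n)} {i : Fin n} (hi : i ∉ s) :
    (2 * n - #s + 2) * vandermondeMoment a b (insert i s) =
      (b - a) * (n - #s + 1) * vandermondeMoment a b s := by
  obtain _ | n := n
  · exact i.elim0
  obtain ⟨t, -, ht⟩ : ∃ t ⊆ (univ : Finset (Fin n)), #t = #s :=
    exists_subset_card_eq (by simpa [Nat.lt_succ_iff] using card_lt_univ_of_notMem hi)
  have h0 : 0 ∉ t.map (Fin.succEmb n) := by simp [Fin.succ_ne_zero]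
  have hrec := vandermondeMoment_insert_zero hab t
  rw [vandermondeMoment_eq_of_card_eq (show #(t.map (Fin.succEmb n)) = #s by simp [ht]),
    vandermondeMoment_eq_of_card_eq (show #(insert 0 (t.map (Fin.succEmb n))) = #(insert i s) by
      rw [card_insert_of_notMem h0, card_insert_of_notMem hi, card_map, ht]), ht] at hrec
  push_cast
  linarith

theorem descFactorial_mul_vandermondeMoment (hab : a ≤ b) (s : Finset (Fin n)) :
    ((2 * n + 2).descFactorial #s : ℝ) * vandermondeMoment a b s =
      (b - a) ^ #s * ((n + 1).descFactorial #s : ℝ) *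
        vandermondeMoment a b (∅ : Finset (Fin n)) := by
  induction s using Finset.induction_on with
  | empty => simp
  | insert i s hi ih =>
    have hcard : #s ≤ n := by simpa using card_le_univ s
    rw [card_insert_of_notMem hi, Nat.descFactorial_succ, Nat.descFactorial_succ, Nat.cast_mul,
      Nat.cast_mul, Nat.cast_sub (by lia), Nat.cast_sub (by lia)]
    push_cast
    calc _ = ((2 * n + 2).descFactorial #s : ℝ) *
          ((2 * n - #s + 2) * vandermondeMoment a b (insert i s)) := by ring
      _ = (b - a) * (n - #s + 1) *
          (((2 * n + 2).descFactorial #s : ℝ) * vandermondeMoment a b s) := by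
        rw [vandermondeMoment_insert hab hi]; ring
      _ = _ := by rw [ih]; ring

theorem vandermondeMoment_empty_succ (hab : a ≤ b) (n : ℕ) :
    (n + 2) * vandermondeMoment a b (∅ : Finset (Fin (n + 1))) =
      2 * (b - a) * vandermondeMoment a b (univ : Finset (Fin n)) := by
  have hparts := integral_deriv_mul_absVandermonde (n := n) hab
    (fun t => (hasDerivAt_id t).sub_const b) (by fun_prop) (Q := fun _ => 1) (by fun_prop)
  have hboundary : ∫ y : Fin n → ℝ, ((id b - b) * ∏ j, |y j - b| - (id a - b) * ∏ j, |y j - a|) *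
      (1 * absVandermonde y) ∂cubeMeasure a b n =
      (b - a) * vandermondeMoment a b (univ : Finset (Fin n)) := by
    rw [vandermondeMoment, ← integral_const_mul, cubeMeasure_eq_restrict]
    refine setIntegral_congr_fun (.univ_pi fun _ => measurableSet_Icc) fun y hy => ?_
    simp only [fun j => abs_of_nonneg (sub_nonneg.2 (hy j (Set.mem_univ j)).1), id]
    ring
  have hterm (j : Fin n) : 2 * ∫ x, (x 0 - b) * ((x 0 - x j.succ)⁻¹ * absVandermonde x)
      ∂cubeMeasure a b (n + 1) = vandermondeMoment a b (∅ : Finset (Fin (n + 1))) := by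
    rw [vandermondeMoment_empty]
    simpa using two_mul_integral_mul_inv_sub_mul_absVandermonde (a := a) (b := b)
      (R := fun _ => 1) (by fun_prop) j fun x => by simp
  rw [hboundary] at hparts
  have hsum := congrArg (2 * ·) hparts
  simp only [id, mul_one, one_mul, ← vandermondeMoment_empty, mul_add, mul_sum, hterm, sum_const,
    card_univ, Fintype.card_fin, nsmul_eq_mul] at hsum
  linarith

end VandermondeMoments

section SelbergIntegral

open MeasureTheory Finset

theorem prod_Icc_two_mul_div (n : ℕ) :
    ∏ j ∈ Icc 1 n, (2 * (j : ℝ) / (2 * (j : ℝ) - 1)) = 4 ^ n / n.centralBinom := by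
  induction n with
  | zero => simp
  | succ n ih =>
    have hne : (n.centralBinom : ℝ) ≠ 0 := by exact_mod_cast n.centralBinom_ne_zero
    have hne' : ((n + 1).centralBinom : ℝ) ≠ 0 := by exact_mod_cast (n + 1).centralBinom_ne_zero
    have hrec : ((n : ℝ) + 1) * (n + 1).centralBinom = 2 * (2 * n + 1) * n.centralBinom := by
      exact_mod_cast n.succ_mul_centralBinom_succ
    rw [prod_Icc_succ_top (by lia), ih, div_mul_div_comm, div_eq_div_iff (by
      refine mul_ne_zero hne ?_
      push_cast
      linarith [(n.cast_nonneg : (0 : ℝ) ≤ n)]) hne']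
    push_cast
    linear_combination 2 * 4 ^ n * hrec

theorem centralBinom_mul_v_succ (n : ℕ) :
    (n + 1) * (n + 1).centralBinom * v (n + 1) = 2 * 4 ^ (n + 1) * v n := by
  have hfactor : ∏ j ∈ Icc 1 (n + 1), (2 * (j : ℝ) / (2 * (j : ℝ) - 1)) ^ (n + 1 + 1 - j) =
      4 ^ (n + 1) / (n + 1).centralBinom *
        ∏ j ∈ Icc 1 n, (2 * (j : ℝ) / (2 * (j : ℝ) - 1)) ^ (n + 1 - j) := by
    rw [← prod_Icc_two_mul_div, prod_Icc_succ_top (by lia), prod_Icc_succ_top (by lia),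
      show n + 1 + 1 - (n + 1) = 1 by lia, pow_one, mul_right_comm, ← prod_mul_distrib]
    congr 1
    refine prod_congr rfl fun j hj => ?_
    rw [← pow_succ', Nat.succ_sub (by grind)]
  have hne : ((n + 1).centralBinom : ℝ) ≠ 0 := by exact_mod_cast (n + 1).centralBinom_ne_zero
  rw [v, v, hfactor, Nat.factorial_succ]
  push_cast
  field_simp
  ring

theorem centralBinom_mul_integral_absVandermonde_succ {a b : ℝ} (hab : a ≤ b) (n : ℕ) :
    (n + 1).centralBinom * ∫ x, absVandermonde x ∂cubeMeasure a b (n + 1) =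
      2 * (b - a) ^ (n + 1) * ∫ x, absVandermonde x ∂cubeMeasure a b n := by
  have hfull := descFactorial_mul_vandermondeMoment hab (univ : Finset (Fin n))
  have hstep := vandermondeMoment_empty_succ hab n
  have hbinom : ((n : ℝ) + 2) * (2 * n + 2).descFactorial n =
      (n + 1).factorial * (n + 1).centralBinom := by
    have := Nat.descFactorial_succ (2 * n + 2) n
    rw [Nat.descFactorial_eq_factorial_mul_choose, show 2 * n + 2 - n = n + 2 by lia] at this
    exact_mod_cast this.symm
  have hfact : (n + 1).descFactorial n = (n + 1).factorial := by
    rw [← Nat.descFactorial_self, Nat.descFactorial_succ, Nat.add_sub_cancel_left, one_mul]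
  rw [card_univ, Fintype.card_fin, hfact] at hfull
  rw [vandermondeMoment_empty] at hfull hstep
  have hne : ((n + 1).factorial : ℝ) ≠ 0 := Nat.cast_ne_zero.2 (n + 1).factorial_ne_zero
  refine mul_left_cancel₀ hne ?_
  rw [← mul_assoc, ← hbinom]
  linear_combination ((2 * n + 2).descFactorial n : ℝ) * hstep + 2 * (b - a) * hfull

theorem integral_absVandermonde {a b : ℝ} (hab : a ≤ b) (n : ℕ) :
    ∫ x, absVandermonde x ∂cubeMeasure a b n =
      n.factorial * v n * ((b - a) / 4) ^ (n + 1).choose 2 := by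
  induction n with
  | zero => simp [v, cubeMeasure, absVandermonde, Measure.real]
  | succ n ih =>
    have hne : ((n + 1).centralBinom : ℝ) ≠ 0 := by exact_mod_cast (n + 1).centralBinom_ne_zero
    have hscale : (b - a) ^ (n + 1) = 4 ^ (n + 1) * ((b - a) / 4) ^ (n + 1) := by
      rw [← mul_pow, mul_div_cancel₀ _ four_ne_zero]
    refine mul_left_cancel₀ hne ?_
    rw [centralBinom_mul_integral_absVandermonde_succ hab, ih, hscale, Nat.factorial_succ,
      Nat.choose_succ_succ' (n + 1) 1, Nat.choose_one_right, pow_add _ (n + 1)]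
    push_cast
    linear_combination -(n.factorial : ℝ) * ((b - a) / 4) ^ (n + 1) *
      ((b - a) / 4) ^ (n + 1).choose 2 * centralBinom_mul_v_succ n

end SelbergIntegral

section ChebyshevBasis

open Polynomial

theorem degree_chebyshevC (m : ℕ) : (Chebyshev.C ℝ m).degree = m := by
  have hX : (C ⅟2 * X : ℝ[X]).natDegree = 1 := natDegree_C_mul_X _ (by norm_num)
  rw [Chebyshev.C_eq_two_mul_T_comp_half_mul_X, ← C_ofNat, degree_C_mul two_ne_zero,
    degree_eq_natDegree, natDegree_comp, hX, Chebyshev.natDegree_T]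
  · simp
  · rw [← leadingCoeff_ne_zero, leadingCoeff_comp (by rw [hX]; exact one_ne_zero)]
    simp

theorem leadingCoeff_chebyshevC {m : ℕ} (hm : m ≠ 0) :
    (Chebyshev.C ℝ m).leadingCoeff = 1 := by
  have hX : (C ⅟2 * X : ℝ[X]).natDegree = 1 := natDegree_C_mul_X _ (by norm_num)
  rw [Chebyshev.C_eq_two_mul_T_comp_half_mul_X, ← C_ofNat, leadingCoeff_mul, leadingCoeff_C,
    leadingCoeff_comp (by rw [hX]; exact one_ne_zero), Chebyshev.natDegree_T,
    Chebyshev.leadingCoeff_T, Int.natAbs_natCast, ← mul_assoc, mul_pow_sub_one hm]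
  simp

/-- The basis `1, C₁, C₂, …` of the real polynomials, where `Cₘ` is the rescaled Chebyshev
polynomial with `Cₘ(z + z⁻¹) = zᵐ + z⁻ᵐ`. The constant `C₀ = 2` is replaced by `1`, so that every
member is monic. -/
noncomputable def chebyshevBasis : Polynomial.Sequence ℝ where
  elems' m := if m = 0 then 1 else Chebyshev.C ℝ m
  degree_eq' m := by
    split_ifs with hm
    · simp [hm]
    · exact degree_chebyshevC m

theorem chebyshevBasis_zero : chebyshevBasis 0 = 1 := by
  simp [chebyshevBasis]

theorem chebyshevBasis_of_ne_zero {m : ℕ} (hm : m ≠ 0) : chebyshevBasis m = Chebyshev.C ℝ m :=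
  if_neg hm

theorem monic_chebyshevBasis (m : ℕ) : (chebyshevBasis m).Monic := by
  rcases eq_or_ne m 0 with rfl | hm
  · rw [chebyshevBasis_zero]
    exact monic_one
  · rw [chebyshevBasis_of_ne_zero hm]
    exact leadingCoeff_chebyshevC hm

theorem aeval_chebyshevBasis {m : ℕ} (hm : m ≠ 0) {z : ℂ} (hz : z ≠ 0) :
    aeval (z + z⁻¹) (chebyshevBasis m) = z ^ m + z⁻¹ ^ m := by
  rw [chebyshevBasis_of_ne_zero hm, Chebyshev.aeval_C, ← dickson_one_one_eq_chebyshev_C,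
    dickson_one_one_eval_add_inv _ _ (mul_inv_cancel₀ hz)]

theorem eval_two_chebyshevBasis_ne_zero (m : ℕ) : (chebyshevBasis m).eval 2 ≠ 0 := by
  rcases eq_or_ne m 0 with rfl | hm
  · simp [chebyshevBasis_zero]
  · simp [chebyshevBasis_of_ne_zero hm]

theorem eval_neg_two_chebyshevBasis_ne_zero (m : ℕ) : (chebyshevBasis m).eval (-2) ≠ 0 := by
  rcases eq_or_ne m 0 with rfl | hm
  · simp [chebyshevBasis_zero]
  · simp [chebyshevBasis_of_ne_zero hm, Chebyshev.C_eval_neg_two]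

theorem derivative_chebyshevC (m : ℕ) :
    derivative (Chebyshev.C ℝ m) = C (m : ℝ) * Chebyshev.S ℝ (m - 1) := by
  rw [Chebyshev.C_eq_two_mul_T_comp_half_mul_X, Chebyshev.S_eq_U_comp_half_mul_X, ← C_ofNat,
    derivative_C_mul, derivative_comp, Chebyshev.T_derivative_eq_U, mul_comp, derivative_C_mul,
    derivative_X, mul_one, ← mul_assoc, ← C_mul, mul_invOf_self, C_1, one_mul]
  simp

theorem separable_chebyshevC {m : ℕ} (hm : m ≠ 0) : (Chebyshev.C ℝ m).Separable := by
  have hcoprime : IsCoprime (Chebyshev.S ℝ m) (Chebyshev.S ℝ (m - 1)) := by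
    refine ⟨Chebyshev.S ℝ m - X * Chebyshev.S ℝ (m - 1), Chebyshev.S ℝ (m - 1), ?_⟩
    have hS := Chebyshev.S_sq_add_S_sq ℝ (m - 1)
    rw [sub_add_cancel] at hS
    linear_combination hS
  have htwo : IsUnit (2 : ℝ[X]) := isUnit_C.2 (isUnit_iff_ne_zero.2 two_ne_zero)
  have hunit : IsUnit (C (m : ℝ)) := isUnit_C.2 (isUnit_iff_ne_zero.2 (Nat.cast_ne_zero.2 hm))
  rw [separable_def, derivative_chebyshevC, isCoprime_mul_unit_left_right hunit,
    Chebyshev.C_eq_S_sub_X_mul_S, sub_eq_add_neg, ← neg_mul,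
    IsCoprime.add_mul_right_left_iff, isCoprime_mul_unit_left_left htwo]
  exact hcoprime

theorem squarefree_chebyshevBasis (m : ℕ) : Squarefree (chebyshevBasis m) := by
  rcases eq_or_ne m 0 with rfl | hm
  · rw [chebyshevBasis_zero]
    exact squarefree_one
  · rw [chebyshevBasis_of_ne_zero hm]
    exact (separable_chebyshevC hm).squarefree

end ChebyshevBasis

section TracePolynomial

open Polynomial

variable {n : ℕ}

/-- The monic polynomial `h` of degree `n` with `g b (z) = zⁿ h(z + z⁻¹)`. -/
noncomputable def tracePolynomial (b : Fin n → ℝ) : ℝ[X] :=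
  chebyshevBasis n + ∑ i : Fin n, C (b i) * chebyshevBasis (n - (i + 1))

theorem degree_sum_chebyshevBasis_lt (b : Fin n → ℝ) :
    (∑ i : Fin n, C (b i) * chebyshevBasis (n - (i + 1))).degree < n := by
  refine (degree_sum_le _ _).trans_lt ((Finset.sup_lt_iff (WithBot.bot_lt_coe n)).2 fun i _ => ?_)
  calc (C (b i) * chebyshevBasis (n - (i + 1))).degree
      ≤ (chebyshevBasis (n - (i + 1))).degree := by
        rw [← smul_eq_C_mul]
        exact degree_smul_le _ _
    _ < n := by
        rw [chebyshevBasis.degree_eq]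
        exact_mod_cast Nat.sub_lt i.pos i.val.succ_pos

theorem monic_tracePolynomial (b : Fin n → ℝ) : (tracePolynomial b).Monic :=
  (monic_chebyshevBasis n).add_of_left <| by
    rw [chebyshevBasis.degree_eq]
    exact degree_sum_chebyshevBasis_lt b

theorem natDegree_tracePolynomial (b : Fin n → ℝ) : (tracePolynomial b).natDegree = n := by
  refine natDegree_eq_of_degree_eq_some ?_
  rw [tracePolynomial, degree_add_eq_left_of_degree_lt] <;> rw [chebyshevBasis.degree_eq]
  exact degree_sum_chebyshevBasis_lt b

theorem exists_tracePolynomial_eq {P : ℝ[X]} (hP : P.Monic) (hd : P.natDegree = n) :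
    ∃ b : Fin n → ℝ, tracePolynomial b = P := by
  have hlt : P - chebyshevBasis n ∈ degreeLT ℝ n := by
    have hdeg : P.degree = n := by rw [degree_eq_natDegree hP.ne_zero, hd]
    rw [mem_degreeLT, ← hdeg]
    exact degree_sub_lt_left (by rw [hdeg, chebyshevBasis.degree_eq]) hP.ne_zero
      (by rw [hP.leadingCoeff, (monic_chebyshevBasis n).leadingCoeff])
  have himage : chebyshevBasis '' Set.Iio n =
      Set.range fun i : Fin n => chebyshevBasis (n - (i + 1)) := by
    ext Q
    constructor
    · rintro ⟨k, hk, rfl⟩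
      exact ⟨Fin.rev ⟨k, hk⟩, by
        dsimp only
        rw [← Fin.val_rev, Fin.rev_rev]⟩
    · rintro ⟨i, rfl⟩
      exact ⟨_, Nat.sub_lt i.pos i.val.succ_pos, rfl⟩
  rw [← chebyshevBasis.span_degreeLT fun i _ => by simp [monic_chebyshevBasis i], himage,
    Submodule.mem_span_range_iff_exists_fun] at hlt
  obtain ⟨b, hb⟩ := hlt
  exact ⟨b, by simp only [tracePolynomial, ← smul_eq_C_mul, hb, add_sub_cancel]⟩

theorem tracePolynomial_update (b : Fin n → ℝ) (i : Fin n) (t : ℝ) :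
    tracePolynomial (Function.update b i t) =
      tracePolynomial (Function.update b i 0) + C t * chebyshevBasis (n - (i + 1)) := by
  have hsplit : Function.update b i t = Function.update b i 0 + Pi.single i t := by
    rw [Pi.single, ← Function.update_add, zero_add, add_zero]
  rw [hsplit]
  simp [tracePolynomial, add_mul, Finset.sum_add_distrib, add_assoc, Pi.single_apply, apply_ite C]

theorem pow_mul_aeval_chebyshevBasis {z : ℂ} (hz : z ≠ 0) {m : ℕ} (hm : m ≠ 0) (hmn : m ≤ n) :
    z ^ n * aeval (z + z⁻¹) (chebyshevBasis m) = z ^ (n + m) + z ^ (n - m) := by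
  rw [aeval_chebyshevBasis hm hz, mul_add, ← pow_add, inv_pow, ← pow_sub₀ z hz hmn]

theorem aeval_g (hn : n ≠ 0) (b : Fin n → ℝ) {z : ℂ} (hz : z ≠ 0) :
    aeval z (g b) = z ^ n * aeval (z + z⁻¹) (tracePolynomial b) := by
  have hterm (i : Fin n) :
      aeval z (if (i : ℕ) + 1 < n then C (b i) * (X ^ (2 * n - (i + 1)) + X ^ ((i : ℕ) + 1))
        else C (b i) * X ^ n) =
      z ^ n * aeval (z + z⁻¹) (C (b i) * chebyshevBasis (n - (i + 1))) := by
    rw [map_mul, mul_left_comm]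
    split_ifs with hi
    · rw [pow_mul_aeval_chebyshevBasis hz (Nat.sub_ne_zero_of_lt hi) (Nat.sub_le _ _),
        Nat.sub_sub_self i.2, ← Nat.add_sub_assoc i.2, two_mul]
      simp
    · rw [Nat.sub_eq_zero_of_le (not_lt.1 hi), chebyshevBasis_zero]
      simp
  rw [g, tracePolynomial, map_add (aeval z), map_add (aeval (z + z⁻¹)), mul_add,
    pow_mul_aeval_chebyshevBasis hz hn le_rfl, map_sum, map_sum, Finset.mul_sum,
    Finset.sum_congr rfl fun i _ => hterm i]
  simp [two_mul]

end TracePolynomial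

section CoefficientMap

open Polynomial

variable {n : ℕ}

theorem coeff_g (b : Fin n → ℝ) (k : Fin n) : (g b).coeff (k + 1) = b k := by
  have hterm (i : Fin n) :
      (if (i : ℕ) + 1 < n then C (b i) * (X ^ (2 * n - (i + 1)) + X ^ ((i : ℕ) + 1))
        else C (b i) * X ^ n).coeff (k + 1) = if i = k then b i else 0 := by
    have hik : i = k ↔ (k : ℕ) + 1 = i + 1 := by rw [Fin.ext_iff]; lia
    split_ifs <;> simp only [coeff_C_mul, coeff_add, coeff_X_pow] <;> grind
  rw [g, coeff_add, finsetSum_coeff, Finset.sum_congr rfl fun i _ => hterm i, coeff_add,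
    coeff_X_pow, coeff_one]
  simp only [Nat.add_eq_zero_iff, one_ne_zero, and_false, ↓reduceIte, add_zero,
    Finset.sum_ite_eq', Finset.mem_univ, add_eq_right, ite_eq_right_iff, imp_false]
  lia

/-- The self-reciprocal polynomial `∏ⱼ (X² - xⱼ X + 1)`, whose roots `z` satisfy `z + z⁻¹ = xⱼ` for
some `j`. -/
noncomputable def reciprocalPolynomial (x : Fin n → ℝ) : ℝ[X] :=
  ∏ j, (X ^ 2 - C (x j) * X + 1)

/-- The map from the traces `xⱼ = zⱼ + zⱼ⁻¹` to the vector `b` with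
`g b = ∏ⱼ (X - zⱼ) (X - zⱼ⁻¹)`. -/
noncomputable def coeffMap (x : Fin n → ℝ) : Fin n → ℝ :=
  fun i => (reciprocalPolynomial x).coeff (i + 1)

theorem aeval_reciprocalPolynomial (x : Fin n → ℝ) {z : ℂ} (hz : z ≠ 0) :
    aeval z (reciprocalPolynomial x) = z ^ n * aeval (z + z⁻¹) (∏ j, (X - C (x j))) := by
  have hfactor (j : Fin n) :
      aeval z (X ^ 2 - C (x j) * X + 1 : ℝ[X]) = z * aeval (z + z⁻¹) (X - C (x j)) := by
    simp only [map_add, map_sub, map_mul, map_pow, map_one, aeval_X, aeval_C]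
    field_simp
    ring
  rw [reciprocalPolynomial, map_prod, map_prod, Finset.prod_congr rfl fun j _ => hfactor j,
    Finset.prod_mul_distrib, Fin.prod_const]

theorem g_eq_reciprocalPolynomial (hn : n ≠ 0) {b x : Fin n → ℝ}
    (h : tracePolynomial b = ∏ j, (X - C (x j))) : g b = reciprocalPolynomial x := by
  apply map_injective (algebraMap ℝ ℂ) (algebraMap ℝ ℂ).injective
  refine eq_of_infinite_eval_eq _ _
    ((Set.finite_singleton (0 : ℂ)).infinite_compl.mono fun z (hz : z ≠ 0) => ?_)
  rw [Set.mem_ofPred_eq, eval_map_algebraMap, eval_map_algebraMap, aeval_g hn b hz,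
    aeval_reciprocalPolynomial x hz, h]

theorem coeffMap_eq_of_tracePolynomial_eq (hn : n ≠ 0) {b x : Fin n → ℝ}
    (h : tracePolynomial b = ∏ j, (X - C (x j))) : coeffMap x = b := by
  funext i
  rw [coeffMap, ← g_eq_reciprocalPolynomial hn h, coeff_g]

theorem tracePolynomial_coeffMap (hn : n ≠ 0) (x : Fin n → ℝ) :
    tracePolynomial (coeffMap x) = ∏ j, (X - C (x j)) := by
  obtain ⟨b, hb⟩ := exists_tracePolynomial_eq (n := n) (P := ∏ j, (X - C (x j)))
    (monic_prod_X_sub_C x _) (by simp)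
  rw [coeffMap_eq_of_tracePolynomial_eq hn hb, hb]

theorem contDiff_coeff_reciprocalPolynomial (k : ℕ) :
    ContDiff ℝ 1 fun x : Fin n → ℝ => (reciprocalPolynomial x).coeff k := by
  classical
  suffices h : ∀ (s : Finset (Fin n)) (k : ℕ), ContDiff ℝ 1 fun x : Fin n → ℝ =>
      (∏ j ∈ s, (X ^ 2 - C (x j) * X + 1 : ℝ[X])).coeff k from h Finset.univ k
  intro s
  induction s using Finset.induction_on with
  | empty => exact fun k => contDiff_const
  | insert a s ha ih =>
    intro k
    simp only [Finset.prod_insert ha, coeff_mul]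
    refine ContDiff.sum fun p _ => ContDiff.mul ?_ (ih _)
    simp only [coeff_add, coeff_sub, coeff_C_mul]
    fun_prop

theorem contDiff_coeffMap : ContDiff ℝ 1 (coeffMap (n := n)) :=
  contDiff_pi.2 fun _ => contDiff_coeff_reciprocalPolynomial _

theorem norm_eq_one_of_add_inv_eq {z : ℂ} (hz : z ≠ 0) {x : ℝ} (hx : x ∈ Set.Icc (-2) 2)
    (h : z + z⁻¹ = x) : ‖z‖ = 1 := by
  have hquad : z ^ 2 - x * z + 1 = 0 := by
    rw [← h]
    field_simp
    ring
  have hre : z.re * z.re - z.im * z.im - x * z.re + 1 = 0 := by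
    simpa [pow_two] using congrArg Complex.re hquad
  have him : z.re * z.im + z.im * z.re - x * z.im = 0 := by
    simpa [pow_two] using congrArg Complex.im hquad
  suffices hnorm : Complex.normSq z = 1 by
    rw [Complex.norm_def, hnorm, Real.sqrt_one]
  rw [Complex.normSq_apply]
  by_cases hz_im : z.im = 0
  · rw [hz_im] at hre ⊢
    have hre_eq : z.re = x / 2 := by nlinarith [sq_nonneg (z.re - x / 2), hx.1, hx.2]
    rw [hre_eq] at hre ⊢
    linarith
  · have hx_eq : x = 2 * z.re := mul_right_cancel₀ hz_im (by linarith)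
    rw [hx_eq] at hre
    linarith

theorem exists_add_inv_eq (w : ℂ) : ∃ z : ℂ, z ≠ 0 ∧ z + z⁻¹ = w := by
  obtain ⟨s, hs⟩ := IsAlgClosed.exists_pow_nat_eq (w ^ 2 - 4) two_pos
  have hmul : (w + s) / 2 * ((w - s) / 2) = 1 := by linear_combination (-1 / 4 : ℂ) * hs
  refine ⟨(w + s) / 2, left_ne_zero_of_mul_eq_one hmul, ?_⟩
  rw [inv_eq_of_mul_eq_one_right hmul]
  ring

theorem exists_mem_Icc_eq_add_inv {z : ℂ} (hz : ‖z‖ = 1) :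
    ∃ x ∈ Set.Icc (-2 : ℝ) 2, (x : ℂ) = z + z⁻¹ := by
  have hre := abs_le.1 ((Complex.abs_re_le_norm z).trans_eq hz)
  refine ⟨2 * z.re, ⟨by linarith, by linarith⟩, ?_⟩
  rw [Complex.inv_eq_conj hz, Complex.add_conj]

theorem exists_eq_prod_X_sub_C {K : Type*} [Field K] {P : K[X]} (hP : P.Monic)
    (hd : P.natDegree = n) (hs : P.Splits) : ∃ x : Fin n → K, P = ∏ j, (X - C (x j)) := by
  have hcard : P.roots.toList.length = n := by
    rw [Multiset.length_toList, ← hs.natDegree_eq_card_roots, hd]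
  subst hcard
  refine ⟨fun j => P.roots.toList[j], ?_⟩
  simp only [Fin.getElem_fin]
  rw [Fin.prod_univ_fun_getElem P.roots.toList fun a => X - C a, Multiset.prod_map_toList]
  exact hs.eq_prod_roots_of_monic hP

theorem coeff_zero_g (hn : n ≠ 0) (b : Fin n → ℝ) : (g b).coeff 0 = 1 := by
  rw [g, coeff_add, finsetSum_coeff, Finset.sum_eq_zero fun i _ => ?_]
  · simp [hn]
  · split_ifs with hi
    · have hexp : 2 * n - (i + 1) ≠ 0 := by lia
      simp [hexp.symm]
    · simp [hn.symm]

theorem ne_zero_of_aeval_g_eq_zero (hn : n ≠ 0) {b : Fin n → ℝ} {z : ℂ} (h : aeval z (g b) = 0) :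
    z ≠ 0 := by
  rintro rfl
  rw [← coeff_zero_eq_aeval_zero', coeff_zero_g hn, map_one] at h
  exact one_ne_zero h

theorem V_eq_image (hn : n ≠ 0) :
    V n = coeffMap '' (Set.univ.pi fun _ : Fin n => Set.Icc (-2 : ℝ) 2) := by
  ext b
  constructor
  · intro hb
    have hroot (w : ℂ) (hw : aeval w (tracePolynomial b) = 0) :
        ∃ x ∈ Set.Icc (-2 : ℝ) 2, (x : ℂ) = w := by
      obtain ⟨z, hz, rfl⟩ := exists_add_inv_eq w
      exact exists_mem_Icc_eq_add_inv (hb z (by rw [aeval_g hn b hz, hw, mul_zero]))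
    have hsplits : (tracePolynomial b).Splits := by
      refine Splits.of_splits_map (algebraMap ℝ ℂ) (IsAlgClosed.splits _) fun w hw => ?_
      rw [mem_roots_map (monic_tracePolynomial b).ne_zero] at hw
      obtain ⟨x, -, hx⟩ := hroot w hw
      exact ⟨x, hx⟩
    obtain ⟨x, hx⟩ := exists_eq_prod_X_sub_C (monic_tracePolynomial b)
      (natDegree_tracePolynomial b) hsplits
    refine ⟨x, fun j _ => ?_, coeffMap_eq_of_tracePolynomial_eq hn hx⟩
    obtain ⟨y, hy, hyx⟩ := hroot (x j) <| by
      rw [hx, map_prod]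
      exact Finset.prod_eq_zero (Finset.mem_univ j) (by simp)
    rwa [← Complex.ofReal_injective hyx]
  · rintro ⟨x, hx, rfl⟩ z hz
    have hz0 := ne_zero_of_aeval_g_eq_zero hn hz
    rw [aeval_g hn _ hz0, tracePolynomial_coeffMap hn, map_prod, mul_eq_zero] at hz
    obtain ⟨j, -, hj⟩ := Finset.prod_eq_zero_iff.1 (hz.resolve_left (pow_ne_zero n hz0))
    have hj' : z + z⁻¹ = x j := by simpa [sub_eq_zero] using hj
    exact norm_eq_one_of_add_inv_eq hz0 (hx j (Set.mem_univ j)) hj'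

theorem isCompact_V (hn : n ≠ 0) : IsCompact (V n) := by
  rw [V_eq_image hn]
  exact (isCompact_univ_pi fun _ => isCompact_Icc).image contDiff_coeffMap.continuous

theorem monic_reciprocalPolynomial (x : Fin n → ℝ) : (reciprocalPolynomial x).Monic :=
  monic_prod_of_monic _ _ fun j _ => by monicity!

theorem natDegree_reciprocalPolynomial (x : Fin n → ℝ) :
    (reciprocalPolynomial x).natDegree = 2 * n := by
  have hfactor (j : Fin n) : (X ^ 2 - C (x j) * X + 1 : ℝ[X]).natDegree = 2 := by compute_degree!
  rw [reciprocalPolynomial, natDegree_prod_of_monic _ _ fun j _ => by monicity!]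
  simp only [hfactor, Fin.sum_const, smul_eq_mul]
  exact mul_comm n 2

theorem abs_le_choose_of_mem_V (hn : n ≠ 0) {b : Fin n → ℝ} (hb : b ∈ V n) (i : Fin n) :
    |b i| ≤ ((2 * n).choose (i + 1) : ℝ) := by
  obtain ⟨x, -, hx⟩ := V_eq_image hn ▸ hb
  have hg : g b = reciprocalPolynomial x :=
    g_eq_reciprocalPolynomial hn (hx ▸ tracePolynomial_coeffMap hn x)
  have hmonic : (g b).Monic := hg ▸ monic_reciprocalPolynomial x
  have hdeg : (g b).natDegree = 2 * n := hg ▸ natDegree_reciprocalPolynomial x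
  have hcoeff := coeff_le_of_roots_le (B := 1) (f := algebraMap ℝ ℂ) (i + 1) hmonic
    (IsAlgClosed.splits _) fun z hz => (hb z ((mem_roots_map hmonic.ne_zero).1 hz)).le
  rw [coeff_map, coeff_g, hdeg, one_pow, one_mul] at hcoeff
  simpa using hcoeff

end CoefficientMap

section PencilOfPolynomials

open Polynomial

variable {K : Type*} [Field K]

theorem wronskian_ne_zero_of_natDegree_lt [CharZero K] {p q : K[X]} (hp : p ≠ 0) (hq : q ≠ 0)
    (hlt : q.natDegree < p.natDegree) : wronskian p q ≠ 0 := by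
  intro h
  have hcoeff := congrArg leadingCoeff (sub_eq_zero.1 h)
  rw [leadingCoeff_mul, leadingCoeff_mul, leadingCoeff_derivative, leadingCoeff_derivative,
    ← mul_assoc, mul_right_comm p.leadingCoeff _ q.leadingCoeff] at hcoeff
  have hlead : p.leadingCoeff * q.leadingCoeff ≠ 0 :=
    mul_ne_zero (leadingCoeff_ne_zero.2 hp) (leadingCoeff_ne_zero.2 hq)
  exact hlt.ne (Nat.cast_injective (mul_left_cancel₀ hlead hcoeff))

theorem eval_wronskian_eq_zero_of_sq_dvd {p q : K[X]} {c t : K}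
    (h : (X - C c) ^ 2 ∣ p + C t * q) : (wronskian p q).eval c = 0 := by
  have hwronskian : wronskian (p + C t * q) q = wronskian p q := by
    rw [wronskian, wronskian, derivative_add, derivative_C_mul]
    ring
  obtain ⟨u, hu⟩ := h
  rw [← hwronskian, hu, wronskian]
  simp [derivative_pow]

theorem eq_of_sq_dvd_of_squarefree {p q : K[X]} (hq : Squarefree q) {c t t' : K}
    (h : (X - C c) ^ 2 ∣ p + C t * q) (h' : (X - C c) ^ 2 ∣ p + C t' * q) : t = t' := by
  by_contra hne
  have hunit : IsUnit (C (t - t')) := isUnit_C.2 (sub_ne_zero.2 hne).isUnit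
  have hdvd : (X - C c) ^ 2 ∣ q := by
    rw [← hunit.dvd_mul_left, C_sub, sub_mul,
      ← add_sub_add_left_eq_sub (C t * q) (C t' * q) p]
    exact dvd_sub h h'
  exact not_isUnit_X_sub_C c (hq _ (pow_two (X - C c) ▸ hdvd))

-- Multiple roots of members of the pencil are roots of the Wronskian of `p` and `q`.
theorem encard_setOf_sq_dvd_le [CharZero K] {p q : K[X]} (hp : p ≠ 0) (hq : Squarefree q)
    (hlt : q.natDegree < p.natDegree) :
    {t : K | ∃ c, (X - C c) ^ 2 ∣ p + C t * q}.encard ≤ (p.natDegree + q.natDegree - 1 : ℕ) := by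
  classical
  have hW := wronskian_ne_zero_of_natDegree_lt hp hq.ne_zero hlt
  choose! root hroot using fun (t : K) (ht : ∃ c, (X - C c) ^ 2 ∣ p + C t * q) => ht
  calc {t : K | ∃ c, (X - C c) ^ 2 ∣ p + C t * q}.encard
      ≤ ((wronskian p q).roots.toFinset : Set K).encard := by
        refine Set.encard_le_encard_of_injOn (f := root) (fun t ht => ?_) fun t ht t' ht' heq => ?_
        · simpa [hW] using eval_wronskian_eq_zero_of_sq_dvd (hroot t ht)
        · exact eq_of_sq_dvd_of_squarefree hq (hroot t ht) (heq ▸ hroot t' ht')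
    _ ≤ (wronskian p q).natDegree := by
        rw [Set.encard_coe_eq_coe_finsetCard]
        exact_mod_cast (Multiset.toFinset_card_le _).trans (card_roots' _)
    _ ≤ (p.natDegree + q.natDegree - 1 : ℕ) := by
        exact_mod_cast Nat.le_sub_one_of_lt (natDegree_wronskian_lt_add hW)

theorem subsingleton_setOf_eval_add_eq_zero {p q : K[X]} {c : K} (hq : q.eval c ≠ 0) :
    {t : K | (p + C t * q).eval c = 0}.Subsingleton := by
  intro t ht t' ht'
  simp only [Set.mem_ofPred_eq, eval_add, eval_mul, eval_C] at ht ht'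
  exact mul_right_cancel₀ hq (add_left_cancel (ht.trans ht'.symm))

end PencilOfPolynomials

section Jacobian

open Polynomial

variable {n : ℕ}

theorem hasFDerivAt_coeffMap (x : Fin n → ℝ) :
    HasFDerivAt coeffMap (fderiv ℝ coeffMap x) x :=
  (contDiff_coeffMap.differentiable one_ne_zero x).hasFDerivAt

theorem eval_tracePolynomial (b : Fin n → ℝ) (c : ℝ) :
    (tracePolynomial b).eval c =
      (chebyshevBasis n).eval c + ∑ i : Fin n, b i * (chebyshevBasis (n - (i + 1))).eval c := by
  simp [tracePolynomial, eval_finsetSum]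

theorem hasDerivAt_coeffMap_update (x : Fin n → ℝ) (j : Fin n) :
    HasDerivAt (fun t => coeffMap (Function.update x j t)) (fderiv ℝ coeffMap x (Pi.single j 1))
      (x j) := by
  have hcomp := (hasFDerivAt_coeffMap (Function.update x j (x j))).comp_hasDerivAt (x j)
    (hasDerivAt_update x j (x j))
  rwa [Function.update_eq_self] at hcomp

theorem coeffMap_comp_perm (x : Fin n → ℝ) (σ : Equiv.Perm (Fin n)) :
    coeffMap (x ∘ σ) = coeffMap x := by
  have hrec : reciprocalPolynomial (x ∘ σ) = reciprocalPolynomial x :=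
    Equiv.prod_comp σ fun j => (X ^ 2 - C (x j) * X + 1 : ℝ[X])
  funext i
  rw [coeffMap, hrec, coeffMap]

theorem fderiv_coeffMap_single_eq {x : Fin n → ℝ} {i j : Fin n} (hij : x i = x j) :
    fderiv ℝ coeffMap x (Pi.single i 1) = fderiv ℝ coeffMap x (Pi.single j 1) := by
  have hswap (t : ℝ) : Function.update x i t ∘ Equiv.swap i j = Function.update x j t := by
    funext k
    simp only [Function.comp_apply, Function.update_apply, Equiv.swap_apply_def]
    split_ifs <;> simp_all
  have hderiv := hasDerivAt_coeffMap_update x j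
  simp only [← hswap, coeffMap_comp_perm, ← hij] at hderiv
  exact (hasDerivAt_coeffMap_update x i).unique hderiv

-- Differentiate `tracePolynomial (coeffMap x) = ∏ₗ (X - xₗ)` with respect to `xⱼ`.
theorem sum_fderiv_coeffMap (hn : n ≠ 0) (x : Fin n → ℝ) (j : Fin n) (c : ℝ) :
    ∑ i : Fin n, fderiv ℝ coeffMap x (Pi.single j 1) i * (chebyshevBasis (n - (i + 1))).eval c =
      -∏ l ∈ Finset.univ.erase j, (c - x l) := by
  have htrace : HasDerivAt (fun t => (tracePolynomial (coeffMap (Function.update x j t))).eval c)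
      (∑ i : Fin n, fderiv ℝ coeffMap x (Pi.single j 1) i *
        (chebyshevBasis (n - (i + 1))).eval c) (x j) := by
    simp only [eval_tracePolynomial]
    exact (HasDerivAt.fun_sum fun i _ =>
      (hasDerivAt_pi.1 (hasDerivAt_coeffMap_update x j) i).mul_const _).const_add _
  have hprod (t : ℝ) : (tracePolynomial (coeffMap (Function.update x j t))).eval c =
      (c - t) * ∏ l ∈ Finset.univ.erase j, (c - x l) := by
    rw [tracePolynomial_coeffMap hn, eval_prod, ← Finset.mul_prod_erase _ _ (Finset.mem_univ j)]
    simp only [eval_sub, eval_X, eval_C, Function.update_self]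
    congr 1
    exact Finset.prod_congr rfl fun l hl => by
      rw [Function.update_of_ne (Finset.ne_of_mem_erase hl)]
  simp only [hprod] at htrace
  refine htrace.unique ?_
  simpa using ((hasDerivAt_id (x j)).const_sub c).mul_const (∏ l ∈ Finset.univ.erase j, (c - x l))

theorem prod_prod_erase_abs_sub (x : Fin n → ℝ) :
    ∏ k, ∏ l ∈ Finset.univ.erase k, |x k - x l| = absVandermonde x ^ 2 := by
  have herase (k : Fin n) : ∏ l ∈ Finset.univ.erase k, |x k - x l| =
      (∏ l ∈ Finset.Iio k, |x k - x l|) * ∏ l ∈ Finset.Ioi k, |x k - x l| := by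
    rw [← Finset.prod_union (Finset.disjoint_left.2 fun l hl hl' =>
      (Finset.mem_Iio.1 hl).not_gt (Finset.mem_Ioi.1 hl'))]
    refine Finset.prod_congr (Finset.ext fun l => ?_) fun _ _ => rfl
    simp [lt_or_lt_iff_ne]
  have hIio : ∏ k, ∏ l ∈ Finset.Iio k, |x k - x l| = absVandermonde x := by
    rw [absVandermonde, Matrix.det_vandermonde]
    simp only [Finset.abs_prod]
    exact Finset.prod_comm' (by simp)
  have hIoi : ∏ k, ∏ l ∈ Finset.Ioi k, |x k - x l| = absVandermonde x := by
    rw [absVandermonde, Matrix.det_vandermonde]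
    simp only [Finset.abs_prod]
    exact Finset.prod_congr rfl fun k _ => Finset.prod_congr rfl fun l _ => abs_sub_comm _ _
  rw [Finset.prod_congr rfl fun k _ => herase k, Finset.prod_mul_distrib, hIio, hIoi, pow_two]

theorem abs_det_eval_chebyshevBasis (x : Fin n → ℝ) :
    |(Matrix.of fun k i : Fin n => (chebyshevBasis (n - (i + 1))).eval (x k)).det| =
      absVandermonde x := by
  have hrev : (Matrix.of fun k i : Fin n => (chebyshevBasis (n - (i + 1))).eval (x k)) =
      (Matrix.of fun i j : Fin n => (chebyshevBasis j).eval (x i)).submatrix id Fin.revPerm := by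
    ext k i
    simp [Fin.val_rev]
  rw [absVandermonde, Matrix.det_eval_matrixOfPolynomials_eq_det_vandermonde x
    (fun i : Fin n => chebyshevBasis i) (fun i => chebyshevBasis.natDegree_eq i)
    fun i => monic_chebyshevBasis i, hrev, ← Equiv.coe_refl,
    Matrix.abs_det_submatrix_equiv_equiv]

-- The matrix of values of the basis at the `xₖ`, times the Jacobian matrix, is diagonal.
theorem abs_det_fderiv_coeffMap_of_injective (hn : n ≠ 0) {x : Fin n → ℝ}
    (hx : Function.Injective x) : |(fderiv ℝ coeffMap x).det| = absVandermonde x := by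
  set J := LinearMap.toMatrix' (fderiv ℝ coeffMap x : (Fin n → ℝ) →ₗ[ℝ] (Fin n → ℝ)) with hJ
  have hdet : (fderiv ℝ coeffMap x).det = J.det := by
    rw [hJ, LinearMap.det_toMatrix', ContinuousLinearMap.det]
  have hmul : (Matrix.of fun k i : Fin n => (chebyshevBasis (n - (i + 1))).eval (x k)) * J =
      Matrix.diagonal fun k => -∏ l ∈ Finset.univ.erase k, (x k - x l) := by
    ext k j
    have hsum := sum_fderiv_coeffMap hn x j (x k)
    simp only [mul_comm] at hsum
    rw [Matrix.mul_apply, Matrix.diagonal_apply]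
    simp only [hJ, LinearMap.toMatrix'_apply, Matrix.of_apply, ContinuousLinearMap.coe_coe]
    rw [hsum]
    split_ifs with hkj
    · rw [hkj]
    · rw [Finset.prod_eq_zero (Finset.mem_erase.2 ⟨hkj, Finset.mem_univ k⟩) (sub_self _), neg_zero]
  have hne : absVandermonde x ≠ 0 := fun h => absVandermonde_eq_zero_iff.1 h hx
  refine mul_left_cancel₀ hne ?_
  calc absVandermonde x * |(fderiv ℝ coeffMap x).det|
      = |((Matrix.of fun k i : Fin n => (chebyshevBasis (n - (i + 1))).eval (x k)) * J).det| := by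
        rw [Matrix.det_mul, abs_mul, abs_det_eval_chebyshevBasis, hdet]
    _ = ∏ k, ∏ l ∈ Finset.univ.erase k, |x k - x l| := by
        rw [hmul, Matrix.det_diagonal]
        simp only [Finset.abs_prod, abs_neg]
    _ = absVandermonde x * absVandermonde x := by
        rw [prod_prod_erase_abs_sub, pow_two]

theorem abs_det_fderiv_coeffMap (hn : n ≠ 0) (x : Fin n → ℝ) :
    |(fderiv ℝ coeffMap x).det| = absVandermonde x := by
  by_cases hx : Function.Injective x
  · exact abs_det_fderiv_coeffMap_of_injective hn hx
  rw [absVandermonde_eq_zero_iff.2 hx, abs_eq_zero, ContinuousLinearMap.det,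
    ← LinearMap.det_toMatrix']
  obtain ⟨i, j, hij, hne⟩ := Function.not_injective_iff.1 hx
  refine Matrix.det_zero_of_column_eq hne fun k => ?_
  simp only [LinearMap.toMatrix'_apply, ContinuousLinearMap.coe_coe, fderiv_coeffMap_single_eq hij]

open Topology in
theorem coeffMap_mem_interior_V (hn : n ≠ 0) {x : Fin n → ℝ} (hx : Function.Injective x)
    (hx' : ∀ j, x j ∈ Set.Ioo (-2 : ℝ) 2) : coeffMap x ∈ interior (V n) := by
  have hdet : (fderiv ℝ coeffMap x).det ≠ 0 := by
    rw [← abs_ne_zero, abs_det_fderiv_coeffMap hn]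
    exact fun h => absVandermonde_eq_zero_iff.1 h hx
  have hstrict : HasStrictFDerivAt coeffMap
      ((fderiv ℝ coeffMap x).toContinuousLinearEquivOfDetNeZero hdet :
        (Fin n → ℝ) →L[ℝ] (Fin n → ℝ)) x := by
    simpa using contDiff_coeffMap.contDiffAt.hasStrictFDerivAt one_ne_zero
  rw [mem_interior_iff_mem_nhds, ← hstrict.map_nhds_eq_of_equiv, V_eq_image hn]
  refine Filter.image_mem_map (Filter.mem_of_superset ?_ (Set.pi_mono fun _ _ =>
    Set.Ioo_subset_Icc_self))
  exact (isOpen_set_pi Set.finite_univ fun _ _ => isOpen_Ioo).mem_nhds fun j _ => hx' j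

end Jacobian

section LineFrontier

open Polynomial

variable {n : ℕ}

theorem sq_dvd_prod_X_sub_C {x : Fin n → ℝ} {i j : Fin n} (hij : i ≠ j) (hx : x i = x j) :
    (X - C (x i)) ^ 2 ∣ ∏ l, (X - C (x l)) := by
  rw [← Finset.mul_prod_erase _ _ (Finset.mem_univ i),
    ← Finset.mul_prod_erase _ _ (Finset.mem_erase.2 ⟨hij.symm, Finset.mem_univ j⟩), hx, pow_two]
  exact mul_dvd_mul_left _ (dvd_mul_right _ _)

theorem eval_or_sq_dvd_of_mem_frontier_V (hn : n ≠ 0) {b : Fin n → ℝ} (hb : b ∈ frontier (V n)) :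
    (∃ c, (X - C c) ^ 2 ∣ tracePolynomial b) ∨ (tracePolynomial b).eval 2 = 0 ∨
      (tracePolynomial b).eval (-2) = 0 := by
  have hmem : b ∈ V n := (isCompact_V hn).isClosed.frontier_subset hb
  rw [V_eq_image hn] at hmem
  obtain ⟨x, hx, rfl⟩ := hmem
  have heval (j : Fin n) : (tracePolynomial (coeffMap x)).eval (x j) = 0 := by
    rw [tracePolynomial_coeffMap hn, eval_prod]
    exact Finset.prod_eq_zero (Finset.mem_univ j) (by simp)
  by_cases hinj : Function.Injective x
  · have hex : ∃ j, x j ∉ Set.Ioo (-2 : ℝ) 2 := by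
      by_contra! hall
      exact hb.2 (coeffMap_mem_interior_V hn hinj hall)
    obtain ⟨j, hj⟩ := hex
    rcases Set.eq_endpoints_or_mem_Ioo_of_mem_Icc (hx j (Set.mem_univ j)) with h | h | h
    · exact .inr (.inr (h ▸ heval j))
    · exact .inr (.inl (h ▸ heval j))
    · exact absurd h hj
  · obtain ⟨i, j, hij, hne⟩ := Function.not_injective_iff.1 hinj
    exact .inl ⟨x i, tracePolynomial_coeffMap hn x ▸ sq_dvd_prod_X_sub_C hne hij⟩

theorem encard_frontier_update_preimage_V_le (hn : n ≠ 0) (b : Fin n → ℝ) (i : Fin n) :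
    (frontier (Function.update b i ⁻¹' V n)).encard ≤ (2 * n : ℕ) := by
  set h := tracePolynomial (Function.update b i 0)
  set T := chebyshevBasis (n - (i + 1))
  have hline (t : ℝ) : tracePolynomial (Function.update b i t) = h + C t * T :=
    tracePolynomial_update b i t
  have hh_deg : h.natDegree = n := natDegree_tracePolynomial _
  have hT_deg : T.natDegree = n - (i + 1) := chebyshevBasis.natDegree_eq _
  have hsub : frontier (Function.update b i ⁻¹' V n) ⊆ {t | ∃ c, (X - C c) ^ 2 ∣ h + C t * T} ∪
      ({t | (h + C t * T).eval 2 = 0} ∪ {t | (h + C t * T).eval (-2) = 0}) := by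
    intro t ht
    have hcont : Continuous (Function.update b i) := continuous_const.update i continuous_id
    have := eval_or_sq_dvd_of_mem_frontier_V hn (hcont.frontier_preimage_subset (V n) ht)
    rwa [hline] at this
  calc (frontier (Function.update b i ⁻¹' V n)).encard
      ≤ (h.natDegree + T.natDegree - 1 : ℕ) + (1 + 1) := by
        refine (Set.encard_le_encard hsub).trans ((Set.encard_union_le _ _).trans ?_)
        gcongr
        · exact encard_setOf_sq_dvd_le (monic_tracePolynomial _).ne_zero
            (squarefree_chebyshevBasis _) (by omega)
        · refine (Set.encard_union_le _ _).trans ?_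
          gcongr
          · exact Set.encard_le_one_iff_subsingleton.2
              (subsingleton_setOf_eval_add_eq_zero (eval_two_chebyshevBasis_ne_zero _))
          · exact Set.encard_le_one_iff_subsingleton.2
              (subsingleton_setOf_eval_add_eq_zero (eval_neg_two_chebyshevBasis_ne_zero _))
    _ ≤ (2 * n : ℕ) := by
        norm_cast
        omega

end LineFrontier

section Symmetrization

open MeasureTheory

variable {n : ℕ}

theorem measurableSet_setOf_strictMono : MeasurableSet {x : Fin n → ℝ | StrictMono x} := by
  simp only [StrictMono, Set.ofPred_forall]
  exact .iInter fun i => .iInter fun j => .iInter fun _ =>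
    measurableSet_lt (measurable_pi_apply i) (measurable_pi_apply j)

theorem iUnion_preimage_comp_perm_setOf_strictMono :
    ⋃ σ : Equiv.Perm (Fin n), (fun x : Fin n → ℝ => x ∘ σ) ⁻¹' {x | StrictMono x} =
      {x | Function.Injective x} := by
  ext x
  simp only [Set.mem_iUnion, Set.mem_preimage, Set.mem_ofPred_eq]
  refine ⟨fun ⟨σ, hσ⟩ => (σ.injective_comp x).1 hσ.injective, fun hx => ⟨Tuple.sort x, ?_⟩⟩
  exact (Tuple.monotone_sort x).strictMono_of_injective (hx.comp (Tuple.sort x).injective)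

theorem pairwise_disjoint_preimage_comp_perm_setOf_strictMono :
    Pairwise (Function.onFun Disjoint fun σ : Equiv.Perm (Fin n) =>
      (fun x : Fin n → ℝ => x ∘ σ) ⁻¹' {x | StrictMono x}) := by
  refine fun σ τ hne => Set.disjoint_left.2 fun x hσ hτ => hne (Equiv.ext fun i => ?_)
  have hx : Function.Injective x := (σ.injective_comp x).1 (StrictMono.injective hσ)
  exact hx (congrFun (Tuple.unique_monotone (StrictMono.monotone hσ) (StrictMono.monotone hτ)) i)

theorem factorial_mul_setLIntegral_strictMono (μ : Measure ℝ) [SigmaFinite μ]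
    {f : (Fin n → ℝ) → ENNReal} (hf : Measurable f)
    (hperm : ∀ (σ : Equiv.Perm (Fin n)) x, f (x ∘ σ) = f x)
    (hzero : ∀ x, ¬ Function.Injective x → f x = 0) :
    n.factorial * ∫⁻ x in {x | StrictMono x}, f x ∂(.pi fun _ => μ) =
      ∫⁻ x, f x ∂(.pi fun _ => μ) := by
  have hpres (σ : Equiv.Perm (Fin n)) := measurePreserving_comp_perm μ σ
  have hpiece (σ : Equiv.Perm (Fin n)) :
      ∫⁻ x in (fun x => x ∘ σ) ⁻¹' {x | StrictMono x}, f x ∂(.pi fun _ => μ) =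
        ∫⁻ x in {x | StrictMono x}, f x ∂(.pi fun _ => μ) := by
    simpa only [hperm] using (hpres σ).setLIntegral_comp_preimage measurableSet_setOf_strictMono hf
  have hinj : ∫⁻ x in {x | Function.Injective x}, f x ∂(.pi fun _ => μ) =
      ∫⁻ x, f x ∂(.pi fun _ => μ) :=
    setLIntegral_eq_of_support_subset fun x hx => by_contra fun h => hx (hzero x h)
  rw [← hinj, ← iUnion_preimage_comp_perm_setOf_strictMono, lintegral_iUnion
    (fun σ => (hpres σ).measurable measurableSet_setOf_strictMono)
    pairwise_disjoint_preimage_comp_perm_setOf_strictMono]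
  simp only [hpiece, tsum_fintype, Finset.sum_const, Finset.card_univ, Fintype.card_perm,
    Fintype.card_fin, nsmul_eq_mul]

end Symmetrization

section Volume

open MeasureTheory Polynomial

variable {n : ℕ}

theorem injOn_coeffMap_setOf_strictMono (hn : n ≠ 0) :
    Set.InjOn (coeffMap (n := n)) {x | StrictMono x} := by
  intro x hx y hy hxy
  have hrange (z : Fin n → ℝ) : Set.range z = {c | (tracePolynomial (coeffMap z)).eval c = 0} := by
    ext c
    rw [Set.mem_ofPred_eq, tracePolynomial_coeffMap hn, eval_prod, Finset.prod_eq_zero_iff]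
    simp [sub_eq_zero, eq_comm]
  exact (StrictMono.range_inj hx hy).1 (by rw [hrange, hrange, hxy])

theorem volume_image_coeffMap_not_injective (hn : n ≠ 0) :
    volume (coeffMap '' {x : Fin n → ℝ | ¬ Function.Injective x}) = 0 :=
  addHaar_image_eq_zero_of_det_fderivWithin_eq_zero volume
    (fun x _ => (hasFDerivAt_coeffMap x).hasFDerivWithinAt) fun x hx => by
      rw [← abs_eq_zero, abs_det_fderiv_coeffMap hn, absVandermonde_eq_zero_iff]
      exact hx

theorem image_coeffMap_inter_setOf_injective (a b : ℝ) :
    coeffMap '' ((Set.univ.pi fun _ : Fin n => Set.Icc a b) ∩ {x | Function.Injective x}) =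
      coeffMap '' ((Set.univ.pi fun _ => Set.Icc a b) ∩ {x | StrictMono x}) := by
  refine (Set.image_subset_iff.2 fun x hx => ?_).antisymm
    (Set.image_mono (Set.inter_subset_inter_right _ fun x hx => StrictMono.injective hx))
  refine ⟨x ∘ Tuple.sort x, ⟨fun j _ => hx.1 _ (Set.mem_univ _), ?_⟩, coeffMap_comp_perm x _⟩
  exact (Tuple.monotone_sort x).strictMono_of_injective (hx.2.comp (Tuple.sort x).injective)

theorem volume_image_coeffMap (hn : n ≠ 0) (a b : ℝ) :
    volume (coeffMap '' Set.univ.pi fun _ : Fin n => Set.Icc a b) =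
      ∫⁻ x in {x | StrictMono x}, ENNReal.ofReal (absVandermonde x) ∂cubeMeasure a b n := by
  set Q := Set.univ.pi fun _ : Fin n => Set.Icc a b
  set S := {x : Fin n → ℝ | StrictMono x}
  have hQS : MeasurableSet (Q ∩ S) :=
    (MeasurableSet.univ_pi fun _ => measurableSet_Icc).inter measurableSet_setOf_strictMono
  calc volume (coeffMap '' Q)
      = volume (coeffMap '' (Q ∩ S)) := by
        nth_rw 1 [← Set.inter_union_compl Q {x | Function.Injective x}, Set.image_union,
          image_coeffMap_inter_setOf_injective]
        refine measure_congr (union_ae_eq_left_of_ae_eq_empty (ae_eq_empty.2 ?_))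
        exact measure_mono_null (Set.image_mono Set.inter_subset_right)
          (volume_image_coeffMap_not_injective hn)
    _ = ∫⁻ x in Q ∩ S, ENNReal.ofReal (absVandermonde x) := by
        rw [← lintegral_abs_det_fderiv_eq_addHaar_image volume hQS
          (fun x _ => (hasFDerivAt_coeffMap x).hasFDerivWithinAt)
          ((injOn_coeffMap_setOf_strictMono hn).mono Set.inter_subset_right)]
        simp only [abs_det_fderiv_coeffMap hn]
    _ = ∫⁻ x in S, ENNReal.ofReal (absVandermonde x) ∂cubeMeasure a b n := by
        rw [cubeMeasure_eq_restrict, Measure.restrict_restrict measurableSet_setOf_strictMono,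
          Set.inter_comm]

theorem volume_real_V (hn : n ≠ 0) : volume.real (V n) = v n := by
  have hsymm := factorial_mul_setLIntegral_strictMono (volume.restrict (Set.Icc (-2 : ℝ) 2))
    (f := fun x : Fin n → ℝ => ENNReal.ofReal (absVandermonde x)) (by fun_prop)
    (fun σ x => by rw [absVandermonde_comp_perm])
    fun x hx => by rw [absVandermonde_eq_zero_iff.2 hx, ENNReal.ofReal_zero]
  have hfactorial : n.factorial * volume.real (V n) = n.factorial * v n := by
    calc n.factorial * volume.real (V n)
        = (∫⁻ x, ENNReal.ofReal (absVandermonde x) ∂cubeMeasure (-2) 2 n).toReal := by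
          rw [cubeMeasure, ← hsymm, V_eq_image hn, measureReal_def, volume_image_coeffMap hn,
            cubeMeasure, ENNReal.toReal_mul, ENNReal.toReal_natCast]
      _ = ∫ x, absVandermonde x ∂cubeMeasure (-2) 2 n :=
          (integral_eq_lintegral_of_nonneg_ae (.of_forall absVandermonde_nonneg)
            continuous_absVandermonde.aestronglyMeasurable).symm
      _ = n.factorial * v n := by
          rw [integral_absVandermonde (by norm_num)]
          norm_num
  exact mul_left_cancel₀ (by positivity) hfactorial

theorem v_nonneg (hn : n ≠ 0) : 0 ≤ v n :=
  volume_real_V hn ▸ measureReal_nonneg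

end Volume

section LatticePointsOfV

open MeasureTheory

variable {n : ℕ}

theorem V_subset_Icc (hn : n ≠ 0) :
    V n ⊆ Set.Icc (fun i => -((2 * n).choose (i + 1) : ℝ)) fun i => (2 * n).choose (i + 1) :=
  fun _ hb => ⟨fun i => (abs_le.1 (abs_le_choose_of_mem_V hn hb i)).1,
    fun i => (abs_le.1 (abs_le_choose_of_mem_V hn hb i)).2⟩

theorem abs_ncard_diagonal_lattice_inter_V_sub_le (hn : n ≠ 0) {d : Fin n → ℝ}
    (hd : ∀ i, 0 < d i) :
    |(((AddSubgroup.closure (Set.range fun i => Pi.single i (d i)) : Set (Fin n → ℝ)) ∩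
        V n).ncard : ℝ) - v n / ∏ i, d i| ≤
      2 * n * ∑ k : Fin n, ∏ j ∈ Finset.univ.erase k,
        (2 * (2 * n).choose (j + 1) / d j + 1) := by
  have hcount := abs_ncard_diagonal_lattice_inter_sub_le hd (isCompact_V hn).measurableSet
    (fun i => neg_le_self (Nat.cast_nonneg _)) (V_subset_Icc hn)
    (encard_frontier_update_preimage_V_le hn)
  simpa only [volume_real_V hn, sub_neg_eq_add, ← two_mul, Nat.cast_mul, Nat.cast_ofNat]
    using hcount

end LatticePointsOfV

section GeneratorLength

variable {n q t : ℕ}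

/-- The lengths of the generators of `scaledLattice n q t`. -/
noncomputable def generatorLength (n q t : ℕ) (i : Fin n) : ℝ :=
  (if (i : ℕ) + 1 = n then (t : ℝ) else 1) * (q : ℝ) ^ (-((i : ℝ) + 1) / 2)

theorem scaledLattice_eq_closure : scaledLattice n q t =
    AddSubgroup.closure (Set.range fun i => Pi.single i (generatorLength n q t i)) := rfl

theorem generatorLength_pos (hq : 1 ≤ q) (ht : 1 ≤ t) (i : Fin n) :
    0 < generatorLength n q t i := by
  rw [generatorLength]
  split_ifs <;> positivity

theorem generatorLength_le_one (hn : 1 < n) (hq : 1 ≤ q) (htq : t ≤ q) (i : Fin n) :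
    generatorLength n q t i ≤ 1 := by
  have hq1 : (1 : ℝ) ≤ q := by exact_mod_cast hq
  rw [generatorLength]
  split_ifs with hi
  · have hi' : (i : ℝ) + 1 = n := by exact_mod_cast hi
    have hn2 : (2 : ℝ) ≤ n := by exact_mod_cast hn
    calc (t : ℝ) * (q : ℝ) ^ (-((i : ℝ) + 1) / 2)
        ≤ q * (q : ℝ) ^ (-((i : ℝ) + 1) / 2) := by gcongr
      _ = (q : ℝ) ^ (1 + -((i : ℝ) + 1) / 2) := by
          rw [Real.rpow_add (by positivity), Real.rpow_one]
      _ ≤ 1 := Real.rpow_le_one_of_one_le_of_nonpos hq1 (by rw [hi']; linarith)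
  · rw [one_mul]
    exact Real.rpow_le_one_of_one_le_of_nonpos hq1 (by linarith [i.val.cast_nonneg (α := ℝ)])

theorem inv_generatorLength_le (hq : 1 ≤ q) (ht : 1 ≤ t) (i : Fin n) :
    (generatorLength n q t i)⁻¹ ≤ (q : ℝ) ^ (((i : ℝ) + 1) / 2) := by
  have hfactor : (1 : ℝ) ≤ if (i : ℕ) + 1 = n then (t : ℝ) else 1 := by
    split_ifs
    · exact_mod_cast ht
    · exact le_rfl
  rw [← inv_inv ((q : ℝ) ^ _), ← Real.rpow_neg q.cast_nonneg, ← neg_div]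
  exact inv_anti₀ (by positivity) (le_mul_of_one_le_left (by positivity) hfactor)

theorem sum_fin_add_one_div_two (n : ℕ) :
    ∑ i : Fin n, ((i : ℝ) + 1) / 2 = (n : ℝ) * (n + 1) / 4 := by
  induction n with
  | zero => simp
  | succ n ih =>
    rw [Fin.sum_univ_castSucc]
    simp only [Fin.val_castSucc, Fin.val_last, ih]
    push_cast
    ring

theorem prod_generatorLength (hn : n ≠ 0) (hq : 1 ≤ q) :
    ∏ i, generatorLength n q t i = t / (q : ℝ) ^ ((n : ℝ) * (n + 1) / 4) := by
  have hfactor : ∏ i : Fin n, (if (i : ℕ) + 1 = n then (t : ℝ) else 1) = t := by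
    obtain ⟨m, rfl⟩ := Nat.exists_eq_succ_of_ne_zero hn
    simp [Fin.prod_univ_castSucc, (Fin.is_lt _).ne]
  have hpow : ∏ i : Fin n, (q : ℝ) ^ (-((i : ℝ) + 1) / 2) =
      ((q : ℝ) ^ ((n : ℝ) * (n + 1) / 4))⁻¹ := by
    rw [← Real.rpow_sum_of_pos (by positivity), ← Real.rpow_neg q.cast_nonneg,
      ← sum_fin_add_one_div_two, ← Finset.sum_neg_distrib]
    simp only [neg_div]
  simp only [generatorLength]
  rw [Finset.prod_mul_distrib, hfactor, hpow, ← div_eq_mul_inv]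

theorem two_mul_centralBinom_lt_four_pow (hn : 1 < n) : 2 * n.centralBinom < 4 ^ n := by
  induction n, hn using Nat.le_induction with
  | base => decide
  | succ m _ ih =>
    have hstep : (m + 1) * (m + 1).centralBinom < (m + 1) * (4 * m.centralBinom) := by
      rw [Nat.succ_mul_centralBinom_succ]
      linarith [m.centralBinom_pos]
    rw [pow_succ]
    linarith [Nat.lt_of_mul_lt_mul_left hstep]

theorem two_mul_choose_div_add_one_le (hn : 1 < n) (hq : 1 ≤ q) (ht : 1 ≤ t) (htq : t ≤ q)
    (j : Fin n) :
    2 * (2 * n).choose (j + 1) / generatorLength n q t j + 1 ≤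
      4 ^ n * (q : ℝ) ^ (((j : ℝ) + 1) / 2) := by
  have hchoose : 2 * ((2 * n).choose (j + 1) : ℝ) + 1 ≤ 4 ^ n := by
    have hle := Nat.choose_le_centralBinom (j + 1) n
    exact_mod_cast show 2 * (2 * n).choose (j + 1) + 1 ≤ 4 ^ n by
      linarith [two_mul_centralBinom_lt_four_pow hn]
  have hpos := generatorLength_pos hq ht j
  calc 2 * (2 * n).choose (j + 1) / generatorLength n q t j + 1
      ≤ 2 * (2 * n).choose (j + 1) / generatorLength n q t j + (generatorLength n q t j)⁻¹ := by
        gcongr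
        exact (one_le_inv₀ hpos).2 (generatorLength_le_one hn hq htq j)
    _ = (2 * (2 * n).choose (j + 1) + 1) * (generatorLength n q t j)⁻¹ := by ring
    _ ≤ 4 ^ n * (q : ℝ) ^ (((j : ℝ) + 1) / 2) :=
        mul_le_mul hchoose (inv_generatorLength_le hq ht j) (by positivity) (by positivity)

theorem prod_erase_two_mul_choose_div_add_one_le (hn : 1 < n) (hq : 1 ≤ q) (ht : 1 ≤ t)
    (htq : t ≤ q) (k : Fin n) :
    ∏ j ∈ Finset.univ.erase k, (2 * (2 * n).choose (j + 1) / generatorLength n q t j + 1) ≤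
      (4 ^ n) ^ (n - 1) * (q : ℝ) ^ (((n : ℝ) + 2) * (n - 1) / 4) := by
  have hq1 : (1 : ℝ) ≤ q := by exact_mod_cast hq
  have hsum := Finset.add_sum_erase Finset.univ (fun i : Fin n => ((i : ℝ) + 1) / 2)
    (Finset.mem_univ k)
  rw [sum_fin_add_one_div_two] at hsum
  calc ∏ j ∈ Finset.univ.erase k, (2 * (2 * n).choose (j + 1) / generatorLength n q t j + 1)
      ≤ ∏ j ∈ Finset.univ.erase k, 4 ^ n * (q : ℝ) ^ (((j : ℝ) + 1) / 2) :=
        Finset.prod_le_prod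
          (fun j _ => by
            have := generatorLength_pos hq ht j
            positivity)
          fun j _ => two_mul_choose_div_add_one_le hn hq ht htq j
    _ = (4 ^ n) ^ (n - 1) *
          (q : ℝ) ^ ∑ j ∈ Finset.univ.erase k, ((j : ℝ) + 1) / 2 := by
        rw [Finset.prod_mul_distrib, Finset.prod_const, Finset.card_erase_of_mem
          (Finset.mem_univ k), Finset.card_fin, Real.rpow_sum_of_pos (by positivity)]
    _ ≤ (4 ^ n) ^ (n - 1) * (q : ℝ) ^ (((n : ℝ) + 2) * (n - 1) / 4) := by
        gcongr
        linarith [k.val.cast_nonneg (α := ℝ)]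

end GeneratorLength

section Constants

variable {n q : ℕ}

theorem factorial_le_pow_sq (n : ℕ) : (n.factorial : ℝ) ≤ (3 / 2) ^ n ^ 2 := by
  induction n with
  | zero => simp
  | succ n ih =>
    have hbernoulli := one_add_mul_le_pow (a := (1 / 2 : ℝ)) (by norm_num) (2 * n + 1)
    calc ((n + 1).factorial : ℝ) = (n + 1) * n.factorial := by push_cast [Nat.factorial_succ]; rfl
      _ ≤ (3 / 2) ^ (2 * n + 1) * (3 / 2) ^ n ^ 2 := by
        gcongr
        norm_num at hbernoulli ⊢
        linarith
      _ = (3 / 2) ^ (n + 1) ^ 2 := by rw [← pow_add]; ring_nf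

theorem c₂_eq : c₂ = c₃ * (1 + √2) := by
  rw [c₃, div_mul_cancel₀ _ (by positivity)]

theorem seventeen_tenths_le_sqrt_three : 17 / 10 ≤ √3 := Real.le_sqrt_of_sq_le (by norm_num)

theorem two_le_c₃ : 2 ≤ c₃ := by
  have hexp : 5 / 2 ≤ Real.exp (3 / 2) := by linarith [Real.add_one_le_exp (3 / 2 : ℝ)]
  have hcube : 1 ≤ (1 + √3 / 162) ^ 3 := one_le_pow₀ (le_add_of_nonneg_right (by positivity))
  calc (2 : ℝ) ≤ 5 / 2 * (17 / 10) * 1 * (2 / 3) := by norm_num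
    _ ≤ Real.exp (3 / 2) * √3 * (1 + √3 / 162) ^ 3 * (2 / 3) := by
        gcongr
        exact seventeen_tenths_le_sqrt_three
    _ = c₃ := by rw [c₃, c₂]; field_simp

theorem quarter_le_c₁ : 1 / 4 ≤ c₁ := by
  rw [c₁]
  linarith [seventeen_tenths_le_sqrt_three]

theorem two_mul_sq_mul_pow_le (hn : n ≠ 0) :
    2 * (n : ℝ) * (n * (4 ^ n) ^ (n - 1)) ≤
      6 ^ (n ^ 2) * c₁ ^ n * c₃ * ((n : ℝ) * (n + 1) / ((n - 1).factorial : ℝ)) := by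
  have hfour : ((4 : ℝ) ^ n) ^ (n - 1) = 4 ^ n ^ 2 * (1 / 4) ^ n := by
    rw [← pow_mul, one_div, inv_pow, eq_mul_inv_iff_mul_eq₀ (by positivity), ← pow_add,
      ← mul_add_one, Nat.sub_one_add_one hn, pow_two]
  have hsix : (6 : ℝ) ^ n ^ 2 = 4 ^ n ^ 2 * (3 / 2) ^ n ^ 2 := by
    rw [← mul_pow]
    norm_num
  have hfactorial : (n : ℝ) * (n - 1).factorial ≤ (3 / 2) ^ n ^ 2 := by
    exact_mod_cast Nat.mul_factorial_pred hn ▸ factorial_le_pow_sq n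
  have hc₁ := quarter_le_c₁
  have hc₃ := two_le_c₃
  rw [mul_div_assoc', le_div_iff₀ (by positivity), hfour, hsix]
  calc 2 * (n : ℝ) * (n * (4 ^ n ^ 2 * (1 / 4) ^ n)) * (n - 1).factorial
      = 4 ^ n ^ 2 * (n * (n - 1).factorial) * (1 / 4) ^ n * 2 * n := by ring
    _ ≤ 4 ^ n ^ 2 * (3 / 2) ^ n ^ 2 * c₁ ^ n * c₃ * (n * (n + 1)) := by
        gcongr
        exact le_mul_of_one_le_right n.cast_nonneg (le_add_of_nonneg_left n.cast_nonneg)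

/-- The error term in the comparison of the number of points of `V n` on a lattice
`scaledLattice n q t` with the volume of `V n` divided by the covolume of the lattice. -/
noncomputable def countingError (n q : ℕ) : ℝ :=
  6 ^ (n ^ 2) * c₁ ^ n * c₃ * ((n : ℝ) * (n + 1) / ((n - 1).factorial : ℝ)) *
    (q : ℝ) ^ (((n : ℝ) + 2) * (n - 1) / 4)

theorem countingError_nonneg : 0 ≤ countingError n q := by
  have := two_le_c₃
  have := quarter_le_c₁
  unfold countingError
  positivity

theorem two_mul_countingError_le : 2 * countingError n q ≤
    6 ^ (n ^ 2) * c₁ ^ n * c₂ * ((n : ℝ) * (n + 1) / ((n - 1).factorial : ℝ)) *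
      (q : ℝ) ^ (((n : ℝ) + 2) * (n - 1) / 4) := by
  have hsqrt : 1 ≤ √2 := Real.one_le_sqrt.2 one_le_two
  calc 2 * countingError n q ≤ (1 + √2) * countingError n q := by
        gcongr
        · exact countingError_nonneg
        · linarith
    _ = _ := by rw [countingError, c₂_eq]; ring

end Constants

section ScaledLattices

variable {n q t : ℕ}

theorem finite_scaledLattice_inter_V (hn : n ≠ 0) (hq : 1 ≤ q) (ht : 1 ≤ t) :
    ((scaledLattice n q t : Set (Fin n → ℝ)) ∩ V n).Finite := by
  rw [scaledLattice_eq_closure]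
  exact finite_diagonal_lattice_inter (generatorLength_pos hq ht) (V_subset_Icc hn)

theorem abs_ncard_scaledLattice_inter_V_sub_le (hn : 1 < n) (ht : 1 ≤ t) (htq : t ≤ q) :
    |(((scaledLattice n q t : Set (Fin n → ℝ)) ∩ V n).ncard : ℝ) -
        v n * (q : ℝ) ^ ((n : ℝ) * (n + 1) / 4) / t| ≤ countingError n q := by
  have hq : 1 ≤ q := ht.trans htq
  have hn0 : n ≠ 0 := by omega
  have hcount := abs_ncard_diagonal_lattice_inter_V_sub_le hn0
    (generatorLength_pos (n := n) hq ht)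
  rw [← scaledLattice_eq_closure, prod_generatorLength hn0 hq, div_div_eq_mul_div] at hcount
  refine hcount.trans ?_
  set E := (q : ℝ) ^ (((n : ℝ) + 2) * (n - 1) / 4)
  calc 2 * n * ∑ k : Fin n, ∏ j ∈ Finset.univ.erase k,
        (2 * (2 * n).choose (j + 1) / generatorLength n q t j + 1)
      ≤ 2 * n * ∑ _k : Fin n, (4 ^ n) ^ (n - 1) * E := by
        gcongr with k
        exact prod_erase_two_mul_choose_div_add_one_le hn hq ht htq k
    _ = 2 * n * (n * (4 ^ n) ^ (n - 1)) * E := by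
        rw [Finset.sum_const, Finset.card_fin, nsmul_eq_mul]
        ring
    _ ≤ countingError n q :=
        mul_le_mul_of_nonneg_right (two_mul_sq_mul_pow_le hn0) (by positivity)

theorem ncard_scaledLattice_inter_V_le (hn : 1 < n) (ht : 1 ≤ t) (htq : t ≤ q) (hqt : q ≤ t ^ 2) :
    (((scaledLattice n q t : Set (Fin n → ℝ)) ∩ V n).ncard : ℝ) ≤
      v n * (q : ℝ) ^ (((n : ℝ) + 2) * (n - 1) / 4) + countingError n q := by
  have hq : 1 ≤ q := ht.trans htq
  have hv := v_nonneg (n := n) (by omega)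
  have hsqrt : (q : ℝ) ^ (1 / 2 : ℝ) ≤ t := by
    rw [← Real.sqrt_eq_rpow]
    exact Real.sqrt_le_iff.2 ⟨t.cast_nonneg, by exact_mod_cast hqt⟩
  have hvolume : v n * (q : ℝ) ^ ((n : ℝ) * (n + 1) / 4) / t ≤
      v n * (q : ℝ) ^ (((n : ℝ) + 2) * (n - 1) / 4) := by
    rw [div_le_iff₀ (by positivity), mul_assoc]
    gcongr
    calc (q : ℝ) ^ ((n : ℝ) * (n + 1) / 4)
        = (q : ℝ) ^ (((n : ℝ) + 2) * (n - 1) / 4) * (q : ℝ) ^ (1 / 2 : ℝ) := by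
          rw [← Real.rpow_add (by positivity)]
          ring_nf
      _ ≤ (q : ℝ) ^ (((n : ℝ) + 2) * (n - 1) / 4) * t := by gcongr
  linarith [le_of_abs_le (abs_ncard_scaledLattice_inter_V_sub_le hn ht htq)]

end ScaledLattices

section PrimePowers

variable {p a : ℕ}

theorem s_mem (p a : ℕ) : (∃ k, s p (p ^ a) = p ^ k) ∧ p ^ a ∣ s p (p ^ a) ^ 2 :=
  Nat.sInf_mem (s := {m | (∃ k, m = p ^ k) ∧ p ^ a ∣ m ^ 2})
    ⟨p ^ a, ⟨a, rfl⟩, dvd_pow_self _ two_ne_zero⟩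

theorem one_le_s (hp : 0 < p) : 1 ≤ s p (p ^ a) := by
  obtain ⟨⟨k, hk⟩, -⟩ := s_mem p a
  exact hk ▸ Nat.one_le_pow _ _ hp

theorem s_le : s p (p ^ a) ≤ p ^ a :=
  Nat.sInf_le ⟨⟨a, rfl⟩, dvd_pow_self _ two_ne_zero⟩

theorem le_s_sq (hp : 0 < p) : p ^ a ≤ s p (p ^ a) ^ 2 :=
  Nat.le_of_dvd (pow_pos (one_le_s hp) 2) (s_mem p a).2

theorem r_prime_pow (hp : p.Prime) (ha : 0 < a) : r (p ^ a) = 1 - 1 / p := by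
  have hp0 : (p : ℝ) ≠ 0 := by exact_mod_cast hp.ne_zero
  rw [r, Nat.totient_prime_pow hp ha, Nat.cast_mul, Nat.cast_pow, Nat.cast_pow,
    Nat.cast_sub hp.one_le, Nat.cast_one, ← pow_sub_one_mul ha.ne' (p : ℝ)]
  field_simp

end PrimePowers

end UnitCircleLattice

theorem proposition3p2p1 (p a q n : ℕ) (hp : p.Prime) (ha : 0 < a) (hq : q = p ^ a)
    (hn : 1 < n) :
    ((UnitCircleLattice.Lam n q : Set (Fin n → ℝ)) ∩ UnitCircleLattice.V n).Finite ∧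
    ((UnitCircleLattice.Lam' n p q : Set (Fin n → ℝ)) ∩ UnitCircleLattice.V n).Finite ∧
    ((UnitCircleLattice.Lam'' n p q : Set (Fin n → ℝ)) ∩ UnitCircleLattice.V n).Finite ∧
    |((((UnitCircleLattice.Lam n q : Set (Fin n → ℝ)) ∩ UnitCircleLattice.V n).ncard : ℕ) : ℝ)
        - ((((UnitCircleLattice.Lam' n p q : Set (Fin n → ℝ)) ∩
              UnitCircleLattice.V n).ncard : ℕ) : ℝ)
        - UnitCircleLattice.v n * UnitCircleLattice.r q *
            (q : ℝ) ^ ((n : ℝ) * ((n : ℝ) + 1) / 4)|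
      ≤ (6 : ℝ) ^ (n ^ 2) * UnitCircleLattice.c₁ ^ n * UnitCircleLattice.c₂ *
          ((n : ℝ) * ((n : ℝ) + 1) / ((n - 1).factorial : ℝ)) *
          (q : ℝ) ^ (((n : ℝ) + 2) * ((n : ℝ) - 1) / 4) ∧
    ((((UnitCircleLattice.Lam'' n p q : Set (Fin n → ℝ)) ∩
          UnitCircleLattice.V n).ncard : ℕ) : ℝ)
      ≤ (UnitCircleLattice.v n +
            (6 : ℝ) ^ (n ^ 2) * UnitCircleLattice.c₁ ^ n * UnitCircleLattice.c₃ *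
              ((n : ℝ) * ((n : ℝ) + 1) / ((n - 1).factorial : ℝ))) *
          (q : ℝ) ^ (((n : ℝ) + 2) * ((n : ℝ) - 1) / 4) := by
  open UnitCircleLattice in
  have hn0 : n ≠ 0 := by omega
  have hpq : p ≤ q := hq ▸ Nat.le_self_pow ha.ne' p
  have hq1 : 1 ≤ q := hp.one_le.trans hpq
  have hs1 : 1 ≤ s p q := hq ▸ one_le_s hp.pos
  have hsq : s p q ≤ q := hq ▸ s_le
  have hqs : q ≤ s p q ^ 2 := hq ▸ le_s_sq hp.pos
  have hr : r q = 1 - 1 / p := hq ▸ r_prime_pow hp ha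
  have hLam := abs_ncard_scaledLattice_inter_V_sub_le hn le_rfl hq1
  have hLam' := abs_ncard_scaledLattice_inter_V_sub_le hn hp.one_le hpq
  have hLam'' := ncard_scaledLattice_inter_V_le hn hs1 hsq hqs
  refine ⟨finite_scaledLattice_inter_V hn0 hq1 le_rfl,
    finite_scaledLattice_inter_V hn0 hq1 hp.one_le,
    finite_scaledLattice_inter_V hn0 hq1 hs1, le_trans ?_ two_mul_countingError_le, ?_⟩
  · rw [two_mul, hr]
    refine (le_of_eq ?_).trans ((abs_sub _ _).trans (add_le_add hLam hLam'))
    rw [Lam, Lam', Nat.cast_one]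
    ring_nf
  · rw [add_mul]
    exact hLam''
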